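/- Let $G$ be a connected, simply connected six-dimensional real Lie group whose Lie algebra $\mathfrak g$ is almost abelian (i.e. has an abelian ideal of codimension one) and not nilpotent. A left-invariant structure on $G$ is identified with the corresponding algebraic structure on $\mathfrak g$: - a left-invariant SKT structure is a pair $(J,g)$, where $J$ is an endomorphism of $\mathfrak g$ with $J^2=-\mathrm{Id}$ and vanishing Nijenhuis tensor, $g$ is an inner product on $\mathfrak g$ with $g(J\cdot,J\cdot)=g$, and the fundamental form $\omega=g(J\cdot,\cdot)$ satisfies $dd^c\omega=0$, with $d^c=-JdJ$; - a left-invariant holomorphic Poisson structure for $J$ is an element $\pi\in\mathfrak g^{2,0}=\Lambda^2\mathfrak g^{1,0}$ with $\overline\partial\pi=0$ and $[\pi,\pi]=0$. Here $\mathfrak g^{1,0}$ and $\mathfrak g^{0,1}$ are the $(\pm i)$-eigenspaces of $J$ on $\mathfrak g\otimes\mathbb C$; for $X\in\mathfrak g^{0,1}$ and $Y,Z\in\mathfrak g^{1,0}$, $\overline\partial_XY=[X,Y]^{1,0}$ and $\overline\partial_X(Y\wedge Z)=\overline\partial_XY\wedge Z+Y\wedge\overline\partial_XZ$; and $[\cdot,\cdot]$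 is the Schouten bracket, $[X_0\wedge X_1,Y_0\wedge Y_1]=\sum_{j,k=0}^{1}(-1)^{j+k}[X_j,Y_k]\wedge X_{j+1}\wedge Y_{k+1}$ (indices mod $2$). Then $G$ admits a left-invariant SKT structure $(J,g)$ such that $J$ has a nonzero left-invariant holomorphic Poisson structure if and only if $\mathfrak g$ is isomorphic to one of the following Lie algebras, each given by the tuple $(df^1,\dots,df^6)$ of differentials of a basis $f^1,\dots,f^6$ of the dual, with $f^{ij}=f^i\wedge f^j$: - $\mathfrak k_{11}^{p,0,0,1}=(p f^{16},f^{36},-f^{26},f^{56},-f^{46},0)$ for some real $p\neq0$; - $\mathfrak k_{13}=(f^{16},0,0,0,0,0)$; - $\mathfrak k_{15}^0=(f^{26},-f^{16},0,0,0,0)$; - $\mathfrak k_{23}^0=(f^{26},-f^{16},f^{46},0,0,0)$; - $\mathfrak k_{25}^{0,0,1}=(f^{26},-f^{16},f^{46},-f^{36},0,0)$. In particular, if such a $G$ (one admitting these structures) is moreover unimodular, meaning $\operatorname{tr}(\operatorname{ad}_X)=0$ for all $X\in\mathfrak g$, then $\mathfrak g$ is decomposable (a direct sum of two nonzero ideals)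 and is isomorphic to $\mathfrak k_{15}^0$, $\mathfrak k_{23}^0$ or $\mathfrak k_{25}^{0,0,1}$. -/

import Mathlib

open scoped Manifold ContDiff TensorProduct

/-- A smooth Lie group is smooth enough for its Lie algebra to be defined. -/
instance : ENat.LEInfty (minSmoothness ℝ 3) := by
  rw [minSmoothness_of_isRCLikeNormedField]
  infer_instance

/-! ## Real Lie algebras -/

section LieAlgebras

variable (L : Type*) [LieRing L] [LieAlgebra ℝ L]

/-- `L` has an abelian ideal of codimension one. -/
def IsAlmostAbelian : Prop :=
  ∃ I : LieIdeal ℝ L, IsLieAbelian I ∧ Module.finrank ℝ (L ⧸ I) = 1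

/-- `tr (ad X) = 0` for every `X`. -/
def IsUnimodular : Prop :=
  ∀ X : L, LinearMap.trace ℝ L (LieAlgebra.ad ℝ L X) = 0

/-- `L` is the direct sum of two nonzero ideals. -/
def IsDecomposable : Prop :=
  ∃ I K : LieIdeal ℝ L, I ≠ ⊥ ∧ K ≠ ⊥ ∧ IsCompl I.toSubmodule K.toSubmodule

end LieAlgebras

/-! ## Hermitian and SKT structures on a real Lie algebra

These encode the left-invariant structures on a Lie group with this Lie algebra: a left-invariant
tensor field is determined by its value at the identity, and on left-invariant forms and vector
fields the exterior derivative and the Lie bracket are the algebraic operations below. -/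

section Hermitian

variable {L : Type*} [LieRing L] [LieAlgebra ℝ L]

/-- `J` is an (integrable) complex structure: `J ^ 2 = -1` and its Nijenhuis tensor vanishes. -/
structure IsComplexStructure (J : L →ₗ[ℝ] L) : Prop where
  sq : ∀ X, J (J X) = -X
  nijenhuis : ∀ X Y, ⁅J X, J Y⁆ - J ⁅J X, Y⁆ - J ⁅X, J Y⁆ - ⁅X, Y⁆ = 0

/-- `(J, g)` is a Hermitian structure: `J` is a complex structure and `g` is an inner product with
`g (J X, J Y) = g (X, Y)`. -/
structure IsHermitianStructure (J : L →ₗ[ℝ] L) (g : LinearMap.BilinForm ℝ L) : Prop where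
  complex : IsComplexStructure J
  symm : ∀ X Y, g X Y = g Y X
  pos : ∀ X, X ≠ 0 → 0 < g X X
  compat : ∀ X Y, g (J X) (J Y) = g X Y

/-- The exterior derivative of a left-invariant 2-form. -/
def extDerivTwo (Ω : L → L → ℝ) : L → L → L → ℝ := fun X Y Z =>
  -Ω ⁅X, Y⁆ Z + Ω ⁅X, Z⁆ Y - Ω ⁅Y, Z⁆ X

/-- The exterior derivative of a left-invariant 3-form. -/
def extDerivThree (c : L → L → L → ℝ) : L → L → L → L → ℝ := fun X Y Z W =>
  -c ⁅X, Y⁆ Z W + c ⁅X, Z⁆ Y W - c ⁅X, W⁆ Y Z - c ⁅Y, Z⁆ X W + c ⁅Y, W⁆ X Z - c ⁅Z, W⁆ X Y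

/-- The fundamental form `Ω (X, Y) = g (J X, Y)`. -/
def fundamentalForm (J : L →ₗ[ℝ] L) (g : LinearMap.BilinForm ℝ L) : L → L → ℝ := fun X Y =>
  g (J X) Y

/-- `d^c = - J d J` on 2-forms, where `J` acts on forms by precomposition in every argument. -/
def dcTwo (J : L →ₗ[ℝ] L) (Ω : L → L → ℝ) : L → L → L → ℝ := fun X Y Z =>
  -extDerivTwo (fun A B => Ω (J A) (J B)) (J X) (J Y) (J Z)

/-- `(J, g)` is SKT: it is Hermitian and `d d^c Ω = 0`. -/
def IsSKT (J : L →ₗ[ℝ] L) (g : LinearMap.BilinForm ℝ L) : Prop :=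
  IsHermitianStructure J g ∧
    ∀ X Y Z W, extDerivThree (dcTwo J (fundamentalForm J g)) X Y Z W = 0

end Hermitian

/-! ## Bivectors -/

section Bivectors

variable {V N : Type*} [AddCommGroup V] [Module ℂ V] [AddCommGroup N] [Module ℂ N]

/-- An alternating bilinear map as an alternating map in two variables. -/
def altTwo (B : V →ₗ[ℂ] V →ₗ[ℂ] N) (hB : ∀ x, B x x = 0) : V [⋀^Fin 2]→ₗ[ℂ] N where
  toFun x := B (x 0) (x 1)
  map_update_add' m i x y := by
    fin_cases i <;> simp [Function.update_of_ne]
  map_update_smul' m i c x := by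
    fin_cases i <;> simp [Function.update_of_ne]
  map_eq_zero_of_eq' v i j h hij := by
    fin_cases i <;> fin_cases j <;> simp_all

/-- The linear map on `Λ²V` with `x ∧ y ↦ B x y`, for an alternating bilinear map `B`. -/
noncomputable def bivectorLift (B : V →ₗ[ℂ] V →ₗ[ℂ] N) (hB : ∀ x, B x x = 0) :
    ⋀[ℂ]^2 V →ₗ[ℂ] N :=
  exteriorPower.alternatingMapLinearEquiv (altTwo B hB)

/-- The bivector `x ∧ y`. -/
noncomputable def wedge (x y : V) : ⋀[ℂ]^2 V := exteriorPower.ιMulti ℂ 2 ![x, y]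

theorem bivectorLift_wedge (B : V →ₗ[ℂ] V →ₗ[ℂ] N) (hB : ∀ x, B x x = 0) (x y : V) :
    bivectorLift B hB (wedge x y) = B x y := by
  simp [bivectorLift, wedge, altTwo]

theorem bivector_hom_ext {f g : ⋀[ℂ]^2 V →ₗ[ℂ] N} (h : ∀ x y, f (wedge x y) = g (wedge x y)) :
    f = g := by
  apply exteriorPower.linearMap_ext
  ext v
  have hv : v = ![v 0, v 1] := by
    ext i
    fin_cases i <;> rfl
  have := h (v 0) (v 1)
  rw [wedge, ← hv] at this
  simpa using this

/-- The Leibniz extension of an endomorphism `D` of `V` to bivectors, with values in the exterior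
algebra: `Y ∧ Z ↦ D Y ∧ Z + Y ∧ D Z`. -/
noncomputable def leibnizTwo (D : V →ₗ[ℂ] V) : ⋀[ℂ]^2 V →ₗ[ℂ] ExteriorAlgebra ℂ V :=
  bivectorLift
    (LinearMap.mk₂ ℂ
      (fun Y Z => ExteriorAlgebra.ι ℂ (D Y) * ExteriorAlgebra.ι ℂ Z +
        ExteriorAlgebra.ι ℂ Y * ExteriorAlgebra.ι ℂ (D Z))
      (fun _ _ _ => by simp only [map_add, add_mul]; abel)
      (fun _ _ _ => by simp only [map_smul, smul_mul_assoc, smul_add])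
      (fun _ _ _ => by simp only [map_add, mul_add]; abel)
      (fun _ _ _ => by simp only [map_smul, mul_smul_comm, smul_add]))
    (fun x => by
      rw [LinearMap.mk₂_apply]
      exact ExteriorAlgebra.ι_add_mul_swap (D x) x)

theorem leibnizTwo_wedge (D : V →ₗ[ℂ] V) (Y Z : V) :
    leibnizTwo D (wedge Y Z) = ExteriorAlgebra.ι ℂ (D Y) * ExteriorAlgebra.ι ℂ Z +
      ExteriorAlgebra.ι ℂ Y * ExteriorAlgebra.ι ℂ (D Z) := by
  simp [leibnizTwo, bivectorLift_wedge]

end Bivectors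

section Schouten

variable {V : Type*} [LieRing V] [LieAlgebra ℂ V]

/-- The trivector `x ∧ y ∧ z`, as an element of the exterior algebra. -/
noncomputable def wedgeThree (x y z : V) : ExteriorAlgebra ℂ V :=
  ExteriorAlgebra.ι ℂ x * ExteriorAlgebra.ι ℂ y * ExteriorAlgebra.ι ℂ z

/-- The Schouten bracket of two decomposable bivectors:
`[X₀ ∧ X₁, Y₀ ∧ Y₁] = ∑_{j,k} (-1)^(j+k) [X_j, Y_k] ∧ X_{j+1} ∧ Y_{k+1}`, indices modulo 2. -/
noncomputable def schoutenFormula (X₀ X₁ Y₀ Y₁ : V) : ExteriorAlgebra ℂ V :=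
  wedgeThree ⁅X₀, Y₀⁆ X₁ Y₁ - wedgeThree ⁅X₀, Y₁⁆ X₁ Y₀
    - wedgeThree ⁅X₁, Y₀⁆ X₀ Y₁ + wedgeThree ⁅X₁, Y₁⁆ X₀ Y₀

/-- The Schouten bracket `[X₀ ∧ X₁, ·]` on bivectors. -/
noncomputable def schoutenLeft (X₀ X₁ : V) : ⋀[ℂ]^2 V →ₗ[ℂ] ExteriorAlgebra ℂ V :=
  bivectorLift
    (LinearMap.mk₂ ℂ (fun Y₀ Y₁ => schoutenFormula X₀ X₁ Y₀ Y₁)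
      (fun _ _ _ => by
        simp only [schoutenFormula, wedgeThree, lie_add, map_add, add_mul, mul_add]; abel)
      (fun _ _ _ => by
        simp only [schoutenFormula, wedgeThree, lie_smul, map_smul, smul_mul_assoc, mul_smul_comm,
          smul_add, smul_sub])
      (fun _ _ _ => by
        simp only [schoutenFormula, wedgeThree, lie_add, map_add, add_mul, mul_add]; abel)
      (fun _ _ _ => by
        simp only [schoutenFormula, wedgeThree, lie_smul, map_smul, smul_mul_assoc, mul_smul_comm,
          smul_add, smul_sub]))
    (fun x => by simp [schoutenFormula])

theorem schoutenLeft_wedge (X₀ X₁ Y₀ Y₁ : V) :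
    schoutenLeft X₀ X₁ (wedge Y₀ Y₁) = schoutenFormula X₀ X₁ Y₀ Y₁ := by
  simp [schoutenLeft, bivectorLift_wedge]

/-- The Schouten bracket on bivectors of a complex Lie algebra, with values in the exterior
algebra. -/
noncomputable def schoutenBracket : ⋀[ℂ]^2 V →ₗ[ℂ] ⋀[ℂ]^2 V →ₗ[ℂ] ExteriorAlgebra ℂ V :=
  bivectorLift
    (LinearMap.mk₂ ℂ (fun X₀ X₁ : V => schoutenLeft X₀ X₁)
      (fun _ _ _ => bivector_hom_ext fun _ _ => by
        simp only [LinearMap.add_apply, schoutenLeft_wedge, schoutenFormula, wedgeThree, add_lie,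
          map_add, add_mul, mul_add]
        abel)
      (fun _ _ _ => bivector_hom_ext fun _ _ => by
        simp only [LinearMap.smul_apply, schoutenLeft_wedge, schoutenFormula, wedgeThree, smul_lie,
          map_smul, smul_mul_assoc, mul_smul_comm, smul_add, smul_sub])
      (fun _ _ _ => bivector_hom_ext fun _ _ => by
        simp only [LinearMap.add_apply, schoutenLeft_wedge, schoutenFormula, wedgeThree, add_lie,
          map_add, add_mul, mul_add]
        abel)
      (fun _ _ _ => bivector_hom_ext fun _ _ => by
        simp only [LinearMap.smul_apply, schoutenLeft_wedge, schoutenFormula, wedgeThree, smul_lie,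
          map_smul, smul_mul_assoc, mul_smul_comm, smul_add, smul_sub]))
    (fun x => bivector_hom_ext fun _ _ => by
      simp [schoutenLeft_wedge, schoutenFormula])

theorem schoutenBracket_wedge (X₀ X₁ Y₀ Y₁ : V) :
    schoutenBracket (wedge X₀ X₁) (wedge Y₀ Y₁) = schoutenFormula X₀ X₁ Y₀ Y₁ := by
  simp [schoutenBracket, bivectorLift_wedge, schoutenLeft_wedge]

end Schouten

/-! ## Holomorphic Poisson structures on a real Lie algebra with complex structure -/

section HolomorphicPoisson

variable {L : Type*} [LieRing L] [LieAlgebra ℝ L]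

/-- The `i`-eigenspace `𝔤^{1,0}` of `J` on `𝔤 ⊗ ℂ`. -/
noncomputable def holomorphicPart (J : L →ₗ[ℝ] L) : Submodule ℂ (ℂ ⊗[ℝ] L) :=
  Module.End.eigenspace (J.baseChange ℂ) Complex.I

/-- The `(-i)`-eigenspace `𝔤^{0,1}` of `J` on `𝔤 ⊗ ℂ`. -/
noncomputable def antiholomorphicPart (J : L →ₗ[ℝ] L) : Submodule ℂ (ℂ ⊗[ℝ] L) :=
  Module.End.eigenspace (J.baseChange ℂ) (-Complex.I)

/-- The space `𝔤^{2,0} = Λ² 𝔤^{1,0}` of (2,0)-vectors, inside `Λ² (𝔤 ⊗ ℂ)`. -/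
noncomputable def bivectorsTwoZero (J : L →ₗ[ℝ] L) : Submodule ℂ (⋀[ℂ]^2 (ℂ ⊗[ℝ] L)) :=
  Submodule.span ℂ {P | ∃ Y ∈ holomorphicPart J, ∃ Z ∈ holomorphicPart J, P = wedge Y Z}

/-- The projection `X ↦ X^{1,0} = (X - i J X) / 2`. -/
noncomputable def projOneZero (J : L →ₗ[ℝ] L) : ℂ ⊗[ℝ] L →ₗ[ℂ] ℂ ⊗[ℝ] L :=
  (1 / 2 : ℂ) • (LinearMap.id - Complex.I • J.baseChange ℂ)

/-- The Cauchy-Riemann operator `Y ↦ [X, Y]^{1,0}` in the direction `X`. -/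
noncomputable def delbar (J : L →ₗ[ℝ] L) (X : ℂ ⊗[ℝ] L) : ℂ ⊗[ℝ] L →ₗ[ℂ] ℂ ⊗[ℝ] L :=
  projOneZero J ∘ₗ (LieAlgebra.ad ℂ (ℂ ⊗[ℝ] L) X : Module.End ℂ (ℂ ⊗[ℝ] L))

/-- `P` is a holomorphic Poisson structure for `J`: it is a (2,0)-vector with
`∂̄_X P = 0` for every `X` of type (0,1), and `[P, P] = 0`. -/
structure IsHolomorphicPoisson (J : L →ₗ[ℝ] L) (P : ⋀[ℂ]^2 (ℂ ⊗[ℝ] L)) : Prop where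
  type_two_zero : P ∈ bivectorsTwoZero J
  holomorphic : ∀ X ∈ antiholomorphicPart J, leibnizTwo (delbar J X) P = 0
  poisson : schoutenBracket P P = 0

end HolomorphicPoisson

/-! ## The Lie algebras of the classification -/

/-- The Lie algebra `ℝ ⋉_B ℝ⁵`, with underlying space `ℝ⁵ × ℝ`. For its standard basis
`e₁, …, e₆` one has `[e₆, e_j] = B e_j` for `j ≤ 5`, and `e₁, …, e₅` commute. In terms of the dual
basis, `df^i = ∑_j B_{ij} f^j ∧ f^6` for `i ≤ 5` and `df^6 = 0`: the rows of `B` are the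
structure equations. -/
def AlmostAbelianAlgebra (_B : Matrix (Fin 5) (Fin 5) ℝ) : Type := (Fin 5 → ℝ) × ℝ

namespace AlmostAbelianAlgebra

variable (B : Matrix (Fin 5) (Fin 5) ℝ)

instance : AddCommGroup (AlmostAbelianAlgebra B) :=
  inferInstanceAs (AddCommGroup ((Fin 5 → ℝ) × ℝ))

instance : Module ℝ (AlmostAbelianAlgebra B) :=
  inferInstanceAs (Module ℝ ((Fin 5 → ℝ) × ℝ))

instance : Bracket (AlmostAbelianAlgebra B) (AlmostAbelianAlgebra B) where
  bracket x y := (x.2 • B.mulVec y.1 - y.2 • B.mulVec x.1, (0 : ℝ))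

theorem bracket_fst (x y : AlmostAbelianAlgebra B) :
    ⁅x, y⁆.1 = x.2 • B.mulVec y.1 - y.2 • B.mulVec x.1 := rfl

theorem bracket_snd (x y : AlmostAbelianAlgebra B) : ⁅x, y⁆.2 = 0 := rfl

theorem add_fst (x y : AlmostAbelianAlgebra B) : (x + y).1 = x.1 + y.1 := rfl

theorem add_snd (x y : AlmostAbelianAlgebra B) : (x + y).2 = x.2 + y.2 := rfl

theorem smul_fst (c : ℝ) (x : AlmostAbelianAlgebra B) : (c • x).1 = c • x.1 := rfl

theorem smul_snd (c : ℝ) (x : AlmostAbelianAlgebra B) : (c • x).2 = c * x.2 := rfl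

instance : LieRing (AlmostAbelianAlgebra B) where
  add_lie x y z := by
    refine Prod.ext ?_ ?_
    · simp only [bracket_fst, add_fst, add_snd, Matrix.mulVec_add, smul_add, add_smul]
      abel
    · simp [bracket_snd, add_snd]
  lie_add x y z := by
    refine Prod.ext ?_ ?_
    · simp only [bracket_fst, add_fst, add_snd, Matrix.mulVec_add, smul_add, add_smul]
      abel
    · simp [bracket_snd, add_snd]
  lie_self x := by
    refine Prod.ext ?_ rfl
    rw [bracket_fst, sub_self]
    rfl
  leibniz_lie x y z := by
    refine Prod.ext ?_ ?_
    · simp only [bracket_fst, bracket_snd, add_fst, Matrix.mulVec_sub, Matrix.mulVec_smul,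
        smul_sub, zero_smul, smul_smul, sub_zero, zero_sub, mul_comm]
      abel
    · simp [bracket_snd, add_snd]

instance : LieAlgebra ℝ (AlmostAbelianAlgebra B) where
  lie_smul c x y := by
    refine Prod.ext ?_ ?_
    · simp only [bracket_fst, smul_fst, smul_snd, Matrix.mulVec_smul, smul_sub, smul_smul,
        mul_comm]
    · simp [bracket_snd, smul_snd]

end AlmostAbelianAlgebra

/-- `𝔨₁₁^{p,q,r,s} = (p f¹⁶, q f²⁶ + f³⁶, -f²⁶ + q f³⁶, r f⁴⁶ + s f⁵⁶, -s f⁴⁶ + r f⁵⁶, 0)`. -/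
abbrev K11 (p q r s : ℝ) : Type := AlmostAbelianAlgebra
  !![p, 0, 0, 0, 0; 0, q, 1, 0, 0; 0, -1, q, 0, 0; 0, 0, 0, r, s; 0, 0, 0, -s, r]

/-- `𝔨₁₃ = (f¹⁶, 0, 0, 0, 0, 0)`. -/
abbrev K13 : Type := AlmostAbelianAlgebra
  !![1, 0, 0, 0, 0; 0, 0, 0, 0, 0; 0, 0, 0, 0, 0; 0, 0, 0, 0, 0; 0, 0, 0, 0, 0]

/-- `𝔨₁₅^p = (p f¹⁶ + f²⁶, -f¹⁶ + p f²⁶, 0, 0, 0, 0)`. -/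
abbrev K15 (p : ℝ) : Type := AlmostAbelianAlgebra
  !![p, 1, 0, 0, 0; -1, p, 0, 0, 0; 0, 0, 0, 0, 0; 0, 0, 0, 0, 0; 0, 0, 0, 0, 0]

/-- `𝔨₂₃^p = (p f¹⁶ + f²⁶, -f¹⁶ + p f²⁶, f⁴⁶, 0, 0, 0)`. -/
abbrev K23 (p : ℝ) : Type := AlmostAbelianAlgebra
  !![p, 1, 0, 0, 0; -1, p, 0, 0, 0; 0, 0, 0, 1, 0; 0, 0, 0, 0, 0; 0, 0, 0, 0, 0]

/-- `𝔨₂₅^{p,q,r} = (p f¹⁶ + f²⁶, -f¹⁶ + p f²⁶, q f³⁶ + r f⁴⁶, -r f³⁶ + q f⁴⁶, 0, 0)`. -/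
abbrev K25 (p q r : ℝ) : Type := AlmostAbelianAlgebra
  !![p, 1, 0, 0, 0; -1, p, 0, 0, 0; 0, 0, q, r, 0; 0, 0, -r, q, 0; 0, 0, 0, 0, 0]

/-- `L` admits an SKT structure `(J, g)` such that `J` has a nonzero holomorphic Poisson
structure. -/
def AdmitsSKTWithHolomorphicPoisson (L : Type*) [LieRing L] [LieAlgebra ℝ L] : Prop :=
  ∃ (J : L →ₗ[ℝ] L) (g : LinearMap.BilinForm ℝ L), IsSKT J g ∧
    ∃ P : ⋀[ℂ]^2 (ℂ ⊗[ℝ] L), P ≠ 0 ∧ IsHolomorphicPoisson J P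

/-! Let e be a unit normal to the abelian ideal. Then Je lies in the ideal, and N, the orthogonal
complement of e and Je, is J-invariant. Vanishing of the Nijenhuis tensor makes ad e preserve N and
commute with J there, so ad e on N is a complex 2×2 matrix. Choosing a unitary basis that starts
with an eigenvector makes it triangular, with eigenvalues λ, μ and off-diagonal entry ν. The
remaining data are the components of [e, Je]: a real number a along Je and a vector v in N.

The SKT condition is quadratic in these data. It forces ν = 0 and puts Re λ and Re μ in {0, -a/2}
(`AdaptedFrame.diagonal_of_skt`). On Λ²𝔤^{1,0} the Cauchy-Riemann operator in the direction of the
(0,1)-part of e is then triangular with diagonal λ+μ, λ+a, μ+a, so a nonzero holomorphic bivector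
makes one of these vanish (`AdaptedFrame.resonance`). The two constraints together give Re λ = Re μ
= 0 and either μ = -λ, or a = 0 with λ or μ equal to zero. Conjugating and rescaling the resulting
real 5×5 matrix yields exactly the five algebras, the case λ = μ = a = 0 being nilpotent
(`classification`).

Conversely, each model carries an explicit complex structure, the standard metric and a decomposable
holomorphic Poisson bivector. The conditions on them are phrased over ℝ, so that they are coordinate
identities and pass through isomorphisms (`AdmitsDecomposableBivector`). The unimodular statement
follows by reading off traces: p for `K11`, 1 for `K13`, and 0 for the other three, which split off
a central line. -/

section Complexification

/-! ### Types (1,0) and (0,1) in terms of real vectors -/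

variable {L : Type*} [LieRing L] [LieAlgebra ℝ L]

/-- The (1,0)-vector `y - i J y`. -/
noncomputable def holVec (J : L →ₗ[ℝ] L) (y : L) : ℂ ⊗[ℝ] L :=
  (1 : ℂ) ⊗ₜ[ℝ] y - Complex.I ⊗ₜ[ℝ] J y

/-- The (0,1)-vector `x + i J x`. -/
noncomputable def antiVec (J : L →ₗ[ℝ] L) (x : L) : ℂ ⊗[ℝ] L :=
  (1 : ℂ) ⊗ₜ[ℝ] x + Complex.I ⊗ₜ[ℝ] J x

/-- The real form of the Cauchy-Riemann operator. -/
noncomputable def crReal (J : L →ₗ[ℝ] L) (x y : L) : L :=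
  (1 / 2 : ℝ) • (⁅x, y⁆ + ⁅J x, J y⁆ + J ⁅J x, y⁆ - J ⁅x, J y⁆)

theorem holVec_add (J : L →ₗ[ℝ] L) (x y : L) : holVec J (x + y) = holVec J x + holVec J y := by
  simp only [holVec, map_add, TensorProduct.tmul_add]; abel

theorem real_smul_tmul (r : ℝ) (c : ℂ) (x : L) :
    c ⊗ₜ[ℝ] (r • x) = (r : ℂ) • (c ⊗ₜ[ℝ] x) := by
  rw [TensorProduct.tmul_smul, TensorProduct.smul_tmul', TensorProduct.smul_tmul']
  simp

theorem holVec_smul (J : L →ₗ[ℝ] L) (r : ℝ) (x : L) :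
    holVec J (r • x) = (r : ℂ) • holVec J x := by
  simp only [holVec, map_smul, real_smul_tmul, smul_sub]

theorem antiVec_smul (J : L →ₗ[ℝ] L) (r : ℝ) (x : L) :
    antiVec J (r • x) = (r : ℂ) • antiVec J x := by
  simp only [antiVec, map_smul, real_smul_tmul, smul_add]

theorem I_smul_tmul_one (x : L) :
    Complex.I • ((1 : ℂ) ⊗ₜ[ℝ] x) = Complex.I ⊗ₜ[ℝ] x := by
  rw [TensorProduct.smul_tmul']; simp

theorem I_smul_tmul_I (x : L) :
    Complex.I • (Complex.I ⊗ₜ[ℝ] x) = -((1 : ℂ) ⊗ₜ[ℝ] x) := by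
  rw [TensorProduct.smul_tmul']; simp [TensorProduct.neg_tmul]

theorem holVec_J {J : L →ₗ[ℝ] L} (hJ : ∀ x, J (J x) = -x) (y : L) :
    holVec J (J y) = Complex.I • holVec J y := by
  simp only [holVec, hJ, smul_sub, I_smul_tmul_one, I_smul_tmul_I, TensorProduct.tmul_neg]
  abel

theorem exists_eq_tmul_add (Z : ℂ ⊗[ℝ] L) :
    ∃ x y : L, Z = (1 : ℂ) ⊗ₜ[ℝ] x + Complex.I ⊗ₜ[ℝ] y := by
  induction Z using TensorProduct.induction_on with
  | zero => exact ⟨0, 0, by simp⟩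
  | tmul c x =>
    refine ⟨c.re • x, c.im • x, ?_⟩
    rw [real_smul_tmul, real_smul_tmul, TensorProduct.smul_tmul', TensorProduct.smul_tmul',
      ← TensorProduct.add_tmul]
    congr 1
    simp
  | add a b ha hb =>
    obtain ⟨x, y, rfl⟩ := ha
    obtain ⟨x', y', rfl⟩ := hb
    refine ⟨x + x', y + y', ?_⟩
    simp only [TensorProduct.tmul_add]
    abel

theorem holVec_mem {J : L →ₗ[ℝ] L} (hJ : ∀ x, J (J x) = -x) (y : L) :
    holVec J y ∈ holomorphicPart J := by
  rw [holomorphicPart, Module.End.mem_eigenspace_iff]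
  simp only [holVec, map_sub, LinearMap.baseChange_tmul, hJ, smul_sub, I_smul_tmul_one,
    I_smul_tmul_I, TensorProduct.tmul_neg]
  abel

theorem antiVec_mem {J : L →ₗ[ℝ] L} (hJ : ∀ x, J (J x) = -x) (y : L) :
    antiVec J y ∈ antiholomorphicPart J := by
  rw [antiholomorphicPart, Module.End.mem_eigenspace_iff]
  simp only [antiVec, map_add, LinearMap.baseChange_tmul, hJ, smul_add, neg_smul, I_smul_tmul_one,
    I_smul_tmul_I, TensorProduct.tmul_neg]
  abel

theorem projOneZero_eq {J : L →ₗ[ℝ] L} (hJ : ∀ x, J (J x) = -x) (x y : L) :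
    projOneZero J ((1 : ℂ) ⊗ₜ[ℝ] x + Complex.I ⊗ₜ[ℝ] y) = holVec J ((1 / 2 : ℝ) • (x + J y)) := by
  rw [holVec_smul, holVec_add, holVec_J hJ]
  simp only [projOneZero, holVec, LinearMap.smul_apply, LinearMap.sub_apply, LinearMap.id_apply,
    map_add, LinearMap.baseChange_tmul, smul_add, smul_sub, I_smul_tmul_one, I_smul_tmul_I]
  push_cast
  simp only [smul_neg]

theorem exists_holVec {J : L →ₗ[ℝ] L} (hJ : ∀ x, J (J x) = -x) {Z : ℂ ⊗[ℝ] L}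
    (hZ : Z ∈ holomorphicPart J) : ∃ y, Z = holVec J y := by
  rw [holomorphicPart, Module.End.mem_eigenspace_iff] at hZ
  obtain ⟨x, y, h⟩ := exists_eq_tmul_add Z
  -- The projection to type (1,0) fixes Z, and its value is given by `projOneZero_eq`.
  refine ⟨(1 / 2 : ℝ) • (x + J y), ?_⟩
  rw [← projOneZero_eq hJ, ← h]
  simp only [projOneZero, LinearMap.smul_apply, LinearMap.sub_apply, LinearMap.id_apply, hZ,
    smul_smul, Complex.I_mul_I]
  module

theorem exists_antiVec {J : L →ₗ[ℝ] L} (hJ : ∀ x, J (J x) = -x) {Z : ℂ ⊗[ℝ] L}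
    (hZ : Z ∈ antiholomorphicPart J) : ∃ y, Z = antiVec J y := by
  rw [antiholomorphicPart, Module.End.mem_eigenspace_iff] at hZ
  obtain ⟨x, y, h⟩ := exists_eq_tmul_add Z
  refine ⟨(1 / 2 : ℝ) • (x - J y), ?_⟩
  have h2 : Z = (1 / 2 : ℂ) • (Z + Complex.I • J.baseChange ℂ Z) := by
    rw [hZ, smul_smul]
    simp only [mul_neg, Complex.I_mul_I]
    module
  rw [h2, h, antiVec_smul]
  simp only [antiVec, map_add, map_sub, hJ, LinearMap.baseChange_tmul, smul_add,
    TensorProduct.tmul_sub, TensorProduct.tmul_neg, I_smul_tmul_one, I_smul_tmul_I]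
  push_cast
  simp only [smul_neg, smul_sub]
  abel

/-- The bracket has real part [x, y] + [Jx, Jy] and imaginary part [Jx, y] - [x, Jy]; projecting it
gives a (1,0)-vector again. This replaces the complex operator by a real one, with multiplication by
i corresponding to J. -/
theorem delbar_antiVec_holVec {J : L →ₗ[ℝ] L} (hJ : ∀ x, J (J x) = -x) (x y : L) :
    delbar J (antiVec J x) (holVec J y) = holVec J (crReal J x y) := by
  have h : ⁅antiVec J x, holVec J y⁆ = (1 : ℂ) ⊗ₜ[ℝ] (⁅x, y⁆ + ⁅J x, J y⁆) +
      Complex.I ⊗ₜ[ℝ] (⁅J x, y⁆ - ⁅x, J y⁆) := by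
    simp only [antiVec, holVec, add_lie, lie_sub, LieAlgebra.ExtendScalars.bracket_tmul, one_mul,
      mul_one, Complex.I_mul_I, TensorProduct.tmul_add, TensorProduct.tmul_sub,
      TensorProduct.neg_tmul]
    abel
  rw [delbar, LinearMap.comp_apply, LieAlgebra.ad_apply, h, projOneZero_eq hJ, crReal]
  congr 2
  rw [map_sub]
  abel

theorem lie_holVec_holVec {J : L →ₗ[ℝ] L} {y z : L} (h1 : ⁅y, z⁆ = ⁅J y, J z⁆)
    (h2 : ⁅J y, z⁆ = -⁅y, J z⁆) : ⁅holVec J y, holVec J z⁆ = 0 := by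
  simp only [holVec, sub_lie, lie_sub, LieAlgebra.ExtendScalars.bracket_tmul, one_mul,
      mul_one, Complex.I_mul_I, h1, h2, TensorProduct.neg_tmul, TensorProduct.tmul_neg]
  abel

/-- The complex linear extension of a real functional. -/
noncomputable def complexFunctional (f : L →ₗ[ℝ] ℝ) : ℂ ⊗[ℝ] L →ₗ[ℂ] ℂ :=
  (TensorProduct.AlgebraTensorModule.rid ℝ ℂ ℂ).toLinearMap ∘ₗ f.baseChange ℂ

theorem complexFunctional_holVec (f : L →ₗ[ℝ] ℝ) (J : L →ₗ[ℝ] L) (y : L) :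
    complexFunctional f (holVec J y) = f y - f (J y) * Complex.I := by
  simp [complexFunctional, holVec]

end Complexification

/-! ### Bivectors detected by pairs of functionals -/

section Functionals

variable {V : Type*} [AddCommGroup V] [Module ℂ V]

/-- The alternating form `(x, y) ↦ φ x ψ y - φ y ψ x`. -/
noncomputable def pairForm (φ ψ : V →ₗ[ℂ] ℂ) : V [⋀^Fin 2]→ₗ[ℂ] ℂ :=
  altTwo (LinearMap.mk₂ ℂ (fun x y => φ x * ψ y - φ y * ψ x)
    (fun _ _ _ => by simp only [map_add]; ring)
    (fun _ _ _ => by simp only [map_smul, smul_eq_mul]; ring)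
    (fun _ _ _ => by simp only [map_add]; ring)
    (fun _ _ _ => by simp only [map_smul, smul_eq_mul]; ring))
    (fun x => by simp)

/-- The functional on the exterior algebra induced by two functionals. -/
noncomputable def pairFunctional (φ ψ : V →ₗ[ℂ] ℂ) : ExteriorAlgebra ℂ V →ₗ[ℂ] ℂ :=
  -- The functional is zero in every degree other than two.
  ExteriorAlgebra.liftAlternating (Pi.single 2 (pairForm φ ψ))

theorem pairFunctional_mul (φ ψ : V →ₗ[ℂ] ℂ) (x y : V) :
    pairFunctional φ ψ (ExteriorAlgebra.ι ℂ x * ExteriorAlgebra.ι ℂ y) =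
      φ x * ψ y - φ y * ψ x := by
  have h := ExteriorAlgebra.liftAlternating_apply_ιMulti (R := ℂ)
    (Pi.single 2 (pairForm φ ψ) : (i : ℕ) → V [⋀^Fin i]→ₗ[ℂ] ℂ) ![x, y]
  rw [ExteriorAlgebra.ιMulti_apply] at h
  simpa [pairFunctional, pairForm, altTwo] using h

theorem coe_wedge (x y : V) : ((wedge x y : ⋀[ℂ]^2 V) : ExteriorAlgebra ℂ V) =
    ExteriorAlgebra.ι ℂ x * ExteriorAlgebra.ι ℂ y := by
  simp [wedge, ExteriorAlgebra.ιMulti_apply]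

theorem wedge_add_left (x x' y : V) : wedge (x + x') y = wedge x y + wedge x' y := by
  apply Subtype.ext
  simp [coe_wedge, add_mul]

theorem wedge_add_right (x y y' : V) : wedge x (y + y') = wedge x y + wedge x y' := by
  apply Subtype.ext
  simp [coe_wedge, mul_add]

theorem wedge_smul_left (c : ℂ) (x y : V) : wedge (c • x) y = c • wedge x y := by
  apply Subtype.ext
  simp [coe_wedge]

theorem wedge_smul_right (c : ℂ) (x y : V) : wedge x (c • y) = c • wedge x y := by
  apply Subtype.ext
  simp [coe_wedge]

theorem wedge_self (x : V) : wedge x x = 0 := by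
  apply Subtype.ext
  simp [coe_wedge]

theorem wedge_swap (x y : V) : wedge y x = -wedge x y := by
  apply Subtype.ext
  simp only [coe_wedge, Submodule.coe_neg]
  exact eq_neg_of_add_eq_zero_left (ExteriorAlgebra.ι_add_mul_swap y x)

end Functionals

/-! ### A real criterion for a decomposable holomorphic Poisson structure -/

section RealCriterion

variable {L : Type*} [LieRing L] [LieAlgebra ℝ L]

/-- A sufficient condition for `(y - i J y) ∧ (z - i J z)` to be a nonzero holomorphic Poisson
structure, in terms of the real Lie algebra. -/
def AdmitsDecomposableBivector (L : Type*) [LieRing L] [LieAlgebra ℝ L] : Prop :=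
  ∃ (J : L →ₗ[ℝ] L) (g : LinearMap.BilinForm ℝ L), IsSKT J g ∧ ∃ (y z : L) (p q r s : L → ℝ)
    (f₁ f₂ : L →ₗ[ℝ] ℝ),
    (∀ x, crReal J x y = q x • y + p x • J y) ∧
    (∀ x, crReal J x z = -q x • z - p x • J z + r x • y + s x • J y) ∧
    ⁅y, z⁆ = ⁅J y, J z⁆ ∧ ⁅J y, z⁆ = -⁅y, J z⁆ ∧
    f₁ y = 1 ∧ f₁ (J y) = 0 ∧ f₁ z = 0 ∧ f₁ (J z) = 0 ∧ f₂ z = 1 ∧ f₂ (J z) = 0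

/-- Write Y, Z for the (1,0)-vectors of y, z. The Cauchy-Riemann operator acts on them by a
triangular matrix with opposite diagonal entries q + ip and -(q + ip), so Y ∧ Z has weight zero; the
terms with r, s die because Y ∧ Y = 0. The bracket conditions say [Y, Z] = 0, which kills the
Schouten bracket. -/
theorem AdmitsDecomposableBivector.admits (h : AdmitsDecomposableBivector L) :
    AdmitsSKTWithHolomorphicPoisson L := by
  obtain ⟨J, g, hS, y, z, p, q, r, s, f₁, f₂, hy, hz, h1, h2, a1, a2, a3, a4, a5, a6⟩ := h
  have hJ := hS.1.complex.sq
  refine ⟨J, g, hS, wedge (holVec J y) (holVec J z), ?_, ?_, ?_, ?_⟩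
  · intro h0
    -- The form f₁ ∧ f₂ takes the value 1 on Y ∧ Z.
    have := congrArg (fun P : ⋀[ℂ]^2 (ℂ ⊗[ℝ] L) => pairFunctional (complexFunctional f₁)
      (complexFunctional f₂) (P : ExteriorAlgebra ℂ (ℂ ⊗[ℝ] L))) h0
    simp [coe_wedge, pairFunctional_mul, complexFunctional_holVec, a1, a2, a3, a4, a5, a6] at this
  · exact Submodule.subset_span ⟨_, holVec_mem hJ y, _, holVec_mem hJ z, rfl⟩
  · intro X hX
    obtain ⟨x, rfl⟩ := exists_antiVec hJ hX
    rw [leibnizTwo_wedge, delbar_antiVec_holVec hJ, delbar_antiVec_holVec hJ, hy, hz]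
    simp only [holVec_add, sub_eq_add_neg, ← neg_smul, holVec_smul, holVec_J hJ, map_add, map_smul, mul_add, add_mul,
      smul_mul_assoc, mul_smul_comm, ExteriorAlgebra.ι_sq_zero]
    push_cast
    module
  · have h0 := lie_holVec_holVec h1 h2
    rw [schoutenBracket_wedge, schoutenFormula, h0, ← lie_skew (holVec J z) (holVec J y), h0]
    simp [wedgeThree]

variable {L' : Type*} [LieRing L'] [LieAlgebra ℝ L']

theorem AdmitsDecomposableBivector.of_equiv (e : L ≃ₗ⁅ℝ⁆ L')
    (h : AdmitsDecomposableBivector L') : AdmitsDecomposableBivector L := by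
  obtain ⟨J, g, ⟨⟨⟨hJ, hN⟩, hs, hp, hc⟩, hd⟩, y, z, p, q, r, s, f₁, f₂, hy, hz, h1, h2, hf⟩ := h
  let E : L →ₗ[ℝ] L' := e.toLinearEquiv.toLinearMap
  let F : L' →ₗ[ℝ] L := e.symm.toLinearEquiv.toLinearMap
  have hE : ∀ x, E x = e x := fun _ => rfl
  have hF : ∀ x, F x = e.symm x := fun _ => rfl
  have hinj : Function.Injective e := e.injective
  have hlie : ∀ x y, e ⁅x, y⁆ = ⁅e x, e y⁆ := fun x y => e.toLieHom.map_lie x y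
  refine ⟨F ∘ₗ J ∘ₗ E, g.comp E E, ⟨⟨⟨?_, ?_⟩, ?_, ?_, ?_⟩, ?_⟩, e.symm y, e.symm z,
    p ∘ e, q ∘ e, r ∘ e, s ∘ e, f₁ ∘ₗ E, f₂ ∘ₗ E, ?_, ?_, ?_, ?_, ?_⟩
  · intro X; simp [hE, hF, hJ]
  · intro X Y
    apply hinj
    simpa [hE, hF, hlie] using hN (e X) (e Y)
  · intro X Y; exact hs _ _
  · intro X hX
    exact hp _ (by simpa [hE] using hX)
  · intro X Y; simpa [hE, hF, hlie] using hc (e X) (e Y)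
  · intro X Y Z W
    simpa [extDerivThree, dcTwo, extDerivTwo, fundamentalForm, hE, hF, hlie] using
      hd (e X) (e Y) (e Z) (e W)
  · intro x
    apply hinj
    simpa [hE, hF, crReal, hlie] using hy (e x)
  · intro x
    apply hinj
    simpa [hE, hF, crReal, hlie] using hz (e x)
  · apply hinj
    simp only [hlie, LinearMap.comp_apply, hE, hF, LieEquiv.apply_symm_apply]
    exact h1
  · apply hinj
    simp only [map_neg, hlie, LinearMap.comp_apply, hE, hF, LieEquiv.apply_symm_apply]
    exact h2
  · simpa [hE, hF, hlie] using hf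

end RealCriterion

/-! ### Coordinates, metric and complex structures on the models -/

namespace AlmostAbelianAlgebra

variable (B : Matrix (Fin 5) (Fin 5) ℝ)

variable {B} in
theorem ext_coord {x y : AlmostAbelianAlgebra B} (h0 : x.1 0 = y.1 0) (h1 : x.1 1 = y.1 1)
    (h2 : x.1 2 = y.1 2) (h3 : x.1 3 = y.1 3) (h4 : x.1 4 = y.1 4) (h5 : x.2 = y.2) : x = y := by
  refine Prod.ext ?_ h5
  funext i
  fin_cases i <;> assumption

theorem lie_coord (x y : AlmostAbelianAlgebra B) (i : Fin 5) :
    ⁅x, y⁆.1 i = x.2 * (∑ j, B i j * y.1 j) - y.2 * ∑ j, B i j * x.1 j := rfl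

theorem add_coord (x y : AlmostAbelianAlgebra B) (i : Fin 5) : (x + y).1 i = x.1 i + y.1 i := rfl

theorem sub_coord (x y : AlmostAbelianAlgebra B) (i : Fin 5) : (x - y).1 i = x.1 i - y.1 i := rfl

theorem neg_coord (x : AlmostAbelianAlgebra B) (i : Fin 5) : (-x).1 i = -x.1 i := rfl

theorem zero_coord (i : Fin 5) : (0 : AlmostAbelianAlgebra B).1 i = 0 := rfl

theorem smul_coord (c : ℝ) (x : AlmostAbelianAlgebra B) (i : Fin 5) :
    (c • x).1 i = c * x.1 i := rfl

theorem sub_snd (x y : AlmostAbelianAlgebra B) : (x - y).2 = x.2 - y.2 := rfl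

theorem neg_snd (x : AlmostAbelianAlgebra B) : (-x).2 = -x.2 := rfl

theorem zero_snd : (0 : AlmostAbelianAlgebra B).2 = 0 := rfl

/-- The vector with the given coordinates. -/
def vec (a b c d e f : ℝ) : AlmostAbelianAlgebra B := (![a, b, c, d, e], f)

theorem vec_fst (a b c d e f : ℝ) : (vec B a b c d e f).1 = ![a, b, c, d, e] := rfl

theorem vec_snd (a b c d e f : ℝ) : (vec B a b c d e f).2 = f := rfl

/-- The standard inner product. -/
def dot : LinearMap.BilinForm ℝ (AlmostAbelianAlgebra B) :=
  LinearMap.mk₂ ℝ (fun x y => x.1 0 * y.1 0 + x.1 1 * y.1 1 + x.1 2 * y.1 2 + x.1 3 * y.1 3 +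
      x.1 4 * y.1 4 + x.2 * y.2)
    (fun _ _ _ => by simp only [add_coord, add_snd]; ring)
    (fun _ _ _ => by simp only [smul_coord, smul_snd, smul_eq_mul]; ring)
    (fun _ _ _ => by simp only [add_coord, add_snd]; ring)
    (fun _ _ _ => by simp only [smul_coord, smul_snd, smul_eq_mul]; ring)

theorem dot_apply (x y : AlmostAbelianAlgebra B) : dot B x y =
    x.1 0 * y.1 0 + x.1 1 * y.1 1 + x.1 2 * y.1 2 + x.1 3 * y.1 3 + x.1 4 * y.1 4 + x.2 * y.2 :=
  rfl

theorem dot_pos (x : AlmostAbelianAlgebra B) (hx : x ≠ 0) : 0 < dot B x x := by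
  rw [dot_apply]
  by_contra h
  apply hx
  have h0 := mul_self_nonneg (x.1 0)
  have h1 := mul_self_nonneg (x.1 1)
  have h2 := mul_self_nonneg (x.1 2)
  have h3 := mul_self_nonneg (x.1 3)
  have h4 := mul_self_nonneg (x.1 4)
  have h5 := mul_self_nonneg x.2
  refine ext_coord ?_ ?_ ?_ ?_ ?_ ?_ <;> refine mul_self_eq_zero.1 ?_ <;> linarith

/-- A coordinate functional. -/
def coord (i : Fin 5) : AlmostAbelianAlgebra B →ₗ[ℝ] ℝ where
  toFun x := x.1 i
  map_add' _ _ := rfl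
  map_smul' _ _ := rfl

theorem coord_apply (i : Fin 5) (x : AlmostAbelianAlgebra B) : coord B i x = x.1 i := rfl

/-- The last coordinate functional. -/
def lastCoord : AlmostAbelianAlgebra B →ₗ[ℝ] ℝ where
  toFun x := x.2
  map_add' _ _ := rfl
  map_smul' _ _ := rfl

theorem lastCoord_apply (x : AlmostAbelianAlgebra B) : lastCoord B x = x.2 := rfl

/-- The complex structure `e₆ ↦ e₁`, `e₂ ↦ e₃`, `e₅ ↦ e₄`. -/
def complexStructureOne : AlmostAbelianAlgebra B →ₗ[ℝ] AlmostAbelianAlgebra B where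
  toFun x := vec B x.2 (-x.1 2) (x.1 1) (x.1 4) (-x.1 3) (-x.1 0)
  map_add' x y := by
    refine ext_coord ?_ ?_ ?_ ?_ ?_ ?_ <;> simp [vec_fst, vec_snd, add_fst, add_snd] <;> ring
  map_smul' c x := by
    refine ext_coord ?_ ?_ ?_ ?_ ?_ ?_ <;> simp [vec_fst, vec_snd, smul_fst, smul_snd]

/-- The complex structure `e₆ ↦ e₅`, `e₁ ↦ e₂`, `e₄ ↦ e₃`. -/
def complexStructureFive : AlmostAbelianAlgebra B →ₗ[ℝ] AlmostAbelianAlgebra B where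
  toFun x := vec B (-x.1 1) (x.1 0) (x.1 3) (-x.1 2) (x.2) (-x.1 4)
  map_add' x y := by
    refine ext_coord ?_ ?_ ?_ ?_ ?_ ?_ <;> simp [vec_fst, vec_snd, add_fst, add_snd] <;> ring
  map_smul' c x := by
    refine ext_coord ?_ ?_ ?_ ?_ ?_ ?_ <;> simp [vec_fst, vec_snd, smul_fst, smul_snd]

/-- The complex structure `e₆ ↦ e₄`, `e₁ ↦ e₂`, `e₃ ↦ e₅`. -/
def complexStructureFour : AlmostAbelianAlgebra B →ₗ[ℝ] AlmostAbelianAlgebra B where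
  toFun x := vec B (-x.1 1) (x.1 0) (-x.1 4) x.2 (x.1 2) (-x.1 3)
  map_add' x y := by
    refine ext_coord ?_ ?_ ?_ ?_ ?_ ?_ <;> simp [vec_fst, vec_snd, add_fst, add_snd] <;> ring
  map_smul' c x := by
    refine ext_coord ?_ ?_ ?_ ?_ ?_ ?_ <;> simp [vec_fst, vec_snd, smul_fst, smul_snd]

theorem complexStructureOne_apply (x : AlmostAbelianAlgebra B) : complexStructureOne B x =
    vec B x.2 (-x.1 2) (x.1 1) (x.1 4) (-x.1 3) (-x.1 0) := rfl

theorem complexStructureFive_apply (x : AlmostAbelianAlgebra B) : complexStructureFive B x =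
    vec B (-x.1 1) (x.1 0) (x.1 3) (-x.1 2) (x.2) (-x.1 4) := rfl

theorem complexStructureFour_apply (x : AlmostAbelianAlgebra B) : complexStructureFour B x =
    vec B (-x.1 1) (x.1 0) (-x.1 4) x.2 (x.1 2) (-x.1 3) := rfl

end AlmostAbelianAlgebra

open AlmostAbelianAlgebra

/-! ### Existence on the five model algebras -/

theorem isSKT_of_dcTwo_eq_zero {L : Type*} [LieRing L] [LieAlgebra ℝ L] {J : L →ₗ[ℝ] L}
    {g : LinearMap.BilinForm ℝ L} (h : IsHermitianStructure J g)
    (hd : ∀ X Y Z, dcTwo J (fundamentalForm J g) X Y Z = 0) : IsSKT J g :=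
  ⟨h, fun X Y Z W => by simp [extDerivThree, hd]⟩

set_option linter.unusedSimpArgs false

/-- The metric is Kähler. Here ad e₆ acts as -J on the plane of e₂ and as +J on the plane of e₄, so
the two weights cancel on the bivector. -/
theorem K11.admits (p : ℝ) : AdmitsDecomposableBivector (K11 p 0 0 1) := by
  refine ⟨complexStructureOne _, dot _, isSKT_of_dcTwo_eq_zero ⟨⟨?_, ?_⟩, ?_, dot_pos _, ?_⟩ ?_,
    vec _ 0 1 0 0 0 0, vec _ 0 0 0 1 0 0, fun x => -x.2, fun x => -x.1 0, fun _ => 0, fun _ => 0, coord _ 1, coord _ 3, ?_, ?_, ?_, ?_, ?_⟩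
  · intro X
    refine ext_coord ?_ ?_ ?_ ?_ ?_ ?_ <;>
      simp [complexStructureOne_apply, vec_fst, vec_snd, neg_coord, neg_snd]
  · intro X Y
    refine ext_coord ?_ ?_ ?_ ?_ ?_ ?_ <;>
      simp [complexStructureOne_apply, vec_fst, vec_snd, sub_coord, sub_snd, zero_coord, zero_snd,
        lie_coord, bracket_snd, Fin.sum_univ_five] <;> ring
  · intro X Y; simp only [dot_apply]; ring
  · intro X Y; simp [dot_apply, complexStructureOne_apply, vec_fst, vec_snd]; ring
  · intro X Y Z
    simp [dcTwo, extDerivTwo, fundamentalForm, dot_apply, complexStructureOne_apply, vec_fst,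
      vec_snd, lie_coord, bracket_snd, Fin.sum_univ_five]
    ring
  · intro x
    refine ext_coord ?_ ?_ ?_ ?_ ?_ ?_ <;>
      simp [crReal, complexStructureOne_apply, vec_fst, vec_snd, sub_coord, sub_snd, add_coord, add_snd, smul_coord, smul_snd,
        neg_coord, neg_snd, zero_coord, zero_snd, lie_coord, bracket_snd,
        Fin.sum_univ_five] <;> ring
  · intro x
    refine ext_coord ?_ ?_ ?_ ?_ ?_ ?_ <;>
      simp [crReal, complexStructureOne_apply, vec_fst, vec_snd, sub_coord, sub_snd, add_coord, add_snd, smul_coord, smul_snd,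
        neg_coord, neg_snd, zero_coord, zero_snd, lie_coord, bracket_snd,
        Fin.sum_univ_five] <;> ring
  · refine ext_coord ?_ ?_ ?_ ?_ ?_ ?_ <;>
      simp [complexStructureOne_apply, vec_fst, vec_snd, lie_coord, bracket_snd, Fin.sum_univ_five]
  · refine ext_coord ?_ ?_ ?_ ?_ ?_ ?_ <;>
      simp [complexStructureOne_apply, vec_fst, vec_snd, lie_coord, bracket_snd, neg_coord, neg_snd,
        Fin.sum_univ_five]
  · simp [complexStructureOne_apply, vec_fst, vec_snd, coord_apply, lastCoord_apply]

theorem K13.admits : AdmitsDecomposableBivector (K13) := by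
  refine ⟨complexStructureOne _, dot _, isSKT_of_dcTwo_eq_zero ⟨⟨?_, ?_⟩, ?_, dot_pos _, ?_⟩ ?_,
    vec _ 0 1 0 0 0 0, vec _ 0 0 0 1 0 0, fun _ => 0, fun _ => 0, fun _ => 0, fun _ => 0, coord _ 1, coord _ 3, ?_, ?_, ?_, ?_, ?_⟩
  · intro X
    refine ext_coord ?_ ?_ ?_ ?_ ?_ ?_ <;>
      simp [complexStructureOne_apply, vec_fst, vec_snd, neg_coord, neg_snd]
  · intro X Y
    refine ext_coord ?_ ?_ ?_ ?_ ?_ ?_ <;>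
      simp [complexStructureOne_apply, vec_fst, vec_snd, sub_coord, sub_snd, zero_coord, zero_snd,
        lie_coord, bracket_snd, Fin.sum_univ_five] <;> ring
  · intro X Y; simp only [dot_apply]; ring
  · intro X Y; simp [dot_apply, complexStructureOne_apply, vec_fst, vec_snd]; ring
  · intro X Y Z
    simp [dcTwo, extDerivTwo, fundamentalForm, dot_apply, complexStructureOne_apply, vec_fst,
      vec_snd, lie_coord, bracket_snd, Fin.sum_univ_five]
    ring
  · intro x
    refine ext_coord ?_ ?_ ?_ ?_ ?_ ?_ <;>
      simp [crReal, complexStructureOne_apply, vec_fst, vec_snd, sub_coord, sub_snd, add_coord, add_snd, smul_coord, smul_snd,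
        neg_coord, neg_snd, zero_coord, zero_snd, lie_coord, bracket_snd,
        Fin.sum_univ_five]
  · intro x
    refine ext_coord ?_ ?_ ?_ ?_ ?_ ?_ <;>
      simp [crReal, complexStructureOne_apply, vec_fst, vec_snd, sub_coord, sub_snd, add_coord, add_snd, smul_coord, smul_snd,
        neg_coord, neg_snd, zero_coord, zero_snd, lie_coord, bracket_snd,
        Fin.sum_univ_five]
  · refine ext_coord ?_ ?_ ?_ ?_ ?_ ?_ <;>
      simp [complexStructureOne_apply, vec_fst, vec_snd, lie_coord, bracket_snd, Fin.sum_univ_five]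
  · refine ext_coord ?_ ?_ ?_ ?_ ?_ ?_ <;>
      simp [complexStructureOne_apply, vec_fst, vec_snd, lie_coord, bracket_snd, neg_coord, neg_snd,
        Fin.sum_univ_five]
  · simp [complexStructureOne_apply, vec_fst, vec_snd, coord_apply, lastCoord_apply]

theorem K15.admits : AdmitsDecomposableBivector (K15 0) := by
  refine ⟨complexStructureFive _, dot _, isSKT_of_dcTwo_eq_zero ⟨⟨?_, ?_⟩, ?_, dot_pos _, ?_⟩ ?_,
    vec _ 0 0 1 0 0 0, vec _ 0 0 0 0 0 1, fun _ => 0, fun _ => 0, fun _ => 0, fun _ => 0, coord _ 2, lastCoord _, ?_, ?_, ?_, ?_, ?_⟩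
  · intro X
    refine ext_coord ?_ ?_ ?_ ?_ ?_ ?_ <;>
      simp [complexStructureFive_apply, vec_fst, vec_snd, neg_coord, neg_snd]
  · intro X Y
    refine ext_coord ?_ ?_ ?_ ?_ ?_ ?_ <;>
      simp [complexStructureFive_apply, vec_fst, vec_snd, sub_coord, sub_snd, zero_coord, zero_snd,
        lie_coord, bracket_snd, Fin.sum_univ_five] <;> ring
  · intro X Y; simp only [dot_apply]; ring
  · intro X Y; simp [dot_apply, complexStructureFive_apply, vec_fst, vec_snd]; ring
  · intro X Y Z
    simp [dcTwo, extDerivTwo, fundamentalForm, dot_apply, complexStructureFive_apply, vec_fst,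
      vec_snd, lie_coord, bracket_snd, Fin.sum_univ_five]
    ring
  · intro x
    refine ext_coord ?_ ?_ ?_ ?_ ?_ ?_ <;>
      simp [crReal, complexStructureFive_apply, vec_fst, vec_snd, sub_coord, sub_snd, add_coord, add_snd, smul_coord, smul_snd,
        neg_coord, neg_snd, zero_coord, zero_snd, lie_coord, bracket_snd,
        Fin.sum_univ_five]
  · intro x
    refine ext_coord ?_ ?_ ?_ ?_ ?_ ?_ <;>
      simp [crReal, complexStructureFive_apply, vec_fst, vec_snd, sub_coord, sub_snd, add_coord, add_snd, smul_coord, smul_snd,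
        neg_coord, neg_snd, zero_coord, zero_snd, lie_coord, bracket_snd,
        Fin.sum_univ_five]
  · refine ext_coord ?_ ?_ ?_ ?_ ?_ ?_ <;>
      simp [complexStructureFive_apply, vec_fst, vec_snd, lie_coord, bracket_snd, Fin.sum_univ_five]
  · refine ext_coord ?_ ?_ ?_ ?_ ?_ ?_ <;>
      simp [complexStructureFive_apply, vec_fst, vec_snd, lie_coord, bracket_snd, neg_coord, neg_snd,
        Fin.sum_univ_five]
  · simp [complexStructureFive_apply, vec_fst, vec_snd, coord_apply, lastCoord_apply]

/-- This is the one model whose chosen metric is only SKT and not Kähler. The bivector uses the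
central vector e₃ and e₆; the nilpotent part [e₆, e₄] = e₃ only contributes multiples of y and Jy.
-/
theorem K23.admits : AdmitsDecomposableBivector (K23 0) := by
  refine ⟨complexStructureFour _, dot _, ⟨⟨⟨?_, ?_⟩, ?_, dot_pos _, ?_⟩, ?_⟩,
    vec _ 0 0 1 0 0 0, vec _ 0 0 0 0 0 1, fun _ => 0, fun _ => 0, fun x => -x.1 3, fun x => -x.2, coord _ 2, lastCoord _, ?_, ?_, ?_, ?_, ?_⟩
  · intro X
    refine ext_coord ?_ ?_ ?_ ?_ ?_ ?_ <;>
      simp [complexStructureFour_apply, vec_fst, vec_snd, neg_coord, neg_snd]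
  · intro X Y
    refine ext_coord ?_ ?_ ?_ ?_ ?_ ?_ <;>
      simp [complexStructureFour_apply, vec_fst, vec_snd, sub_coord, sub_snd, zero_coord, zero_snd,
        lie_coord, bracket_snd, Fin.sum_univ_five] <;> ring
  · intro X Y; simp only [dot_apply]; ring
  · intro X Y; simp [dot_apply, complexStructureFour_apply, vec_fst, vec_snd]; ring
  · have hc : ∀ X Y Z : K23 0, dcTwo (complexStructureFour _) (fundamentalForm
        (complexStructureFour _) (dot _)) X Y Z =
        -(X.1 2 * (Y.1 3 * Z.2 - Y.2 * Z.1 3) - X.1 3 * (Y.1 2 * Z.2 - Y.2 * Z.1 2) +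
          X.2 * (Y.1 2 * Z.1 3 - Y.1 3 * Z.1 2)) := by
      intro X Y Z
      simp [dcTwo, extDerivTwo, fundamentalForm, dot_apply, complexStructureFour_apply, vec_fst,
        vec_snd, lie_coord, bracket_snd, Fin.sum_univ_five]
      ring
    intro X Y Z W
    simp only [extDerivThree, hc]
    simp [lie_coord, bracket_snd, Fin.sum_univ_five]
    ring
  · intro x
    refine ext_coord ?_ ?_ ?_ ?_ ?_ ?_ <;>
      simp [crReal, complexStructureFour_apply, vec_fst, vec_snd, sub_coord, sub_snd, add_coord, add_snd, smul_coord, smul_snd,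
        neg_coord, neg_snd, zero_coord, zero_snd, lie_coord, bracket_snd,
        Fin.sum_univ_five]
  · intro x
    refine ext_coord ?_ ?_ ?_ ?_ ?_ ?_ <;>
      simp [crReal, complexStructureFour_apply, vec_fst, vec_snd, sub_coord, sub_snd, add_coord, add_snd, smul_coord, smul_snd,
        neg_coord, neg_snd, zero_coord, zero_snd, lie_coord, bracket_snd,
        Fin.sum_univ_five] <;> ring
  · refine ext_coord ?_ ?_ ?_ ?_ ?_ ?_ <;>
      simp [complexStructureFour_apply, vec_fst, vec_snd, lie_coord, bracket_snd, Fin.sum_univ_five]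
  · refine ext_coord ?_ ?_ ?_ ?_ ?_ ?_ <;>
      simp [complexStructureFour_apply, vec_fst, vec_snd, lie_coord, bracket_snd, neg_coord, neg_snd,
        Fin.sum_univ_five]
  · simp [complexStructureFour_apply, vec_fst, vec_snd, coord_apply, lastCoord_apply]

/-- Kähler again: the complex structure orients the two rotation planes so that ad e₆ is -J on one
and +J on the other. -/
theorem K25.admits : AdmitsDecomposableBivector (K25 0 0 1) := by
  refine ⟨complexStructureFive _, dot _, isSKT_of_dcTwo_eq_zero ⟨⟨?_, ?_⟩, ?_, dot_pos _, ?_⟩ ?_,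
    vec _ 1 0 0 0 0 0, vec _ 0 0 1 0 0 0, fun x => -x.2, fun x => -x.1 4, fun _ => 0, fun _ => 0, coord _ 0, coord _ 2, ?_, ?_, ?_, ?_, ?_⟩
  · intro X
    refine ext_coord ?_ ?_ ?_ ?_ ?_ ?_ <;>
      simp [complexStructureFive_apply, vec_fst, vec_snd, neg_coord, neg_snd]
  · intro X Y
    refine ext_coord ?_ ?_ ?_ ?_ ?_ ?_ <;>
      simp [complexStructureFive_apply, vec_fst, vec_snd, sub_coord, sub_snd, zero_coord, zero_snd,
        lie_coord, bracket_snd, Fin.sum_univ_five] <;> ring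
  · intro X Y; simp only [dot_apply]; ring
  · intro X Y; simp [dot_apply, complexStructureFive_apply, vec_fst, vec_snd]; ring
  · intro X Y Z
    simp [dcTwo, extDerivTwo, fundamentalForm, dot_apply, complexStructureFive_apply, vec_fst,
      vec_snd, lie_coord, bracket_snd, Fin.sum_univ_five]
    ring
  · intro x
    refine ext_coord ?_ ?_ ?_ ?_ ?_ ?_ <;>
      simp [crReal, complexStructureFive_apply, vec_fst, vec_snd, sub_coord, sub_snd, add_coord, add_snd, smul_coord, smul_snd,
        neg_coord, neg_snd, zero_coord, zero_snd, lie_coord, bracket_snd,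
        Fin.sum_univ_five] <;> ring
  · intro x
    refine ext_coord ?_ ?_ ?_ ?_ ?_ ?_ <;>
      simp [crReal, complexStructureFive_apply, vec_fst, vec_snd, sub_coord, sub_snd, add_coord, add_snd, smul_coord, smul_snd,
        neg_coord, neg_snd, zero_coord, zero_snd, lie_coord, bracket_snd,
        Fin.sum_univ_five] <;> ring
  · refine ext_coord ?_ ?_ ?_ ?_ ?_ ?_ <;>
      simp [complexStructureFive_apply, vec_fst, vec_snd, lie_coord, bracket_snd, Fin.sum_univ_five]
  · refine ext_coord ?_ ?_ ?_ ?_ ?_ ?_ <;>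
      simp [complexStructureFive_apply, vec_fst, vec_snd, lie_coord, bracket_snd, neg_coord, neg_snd,
        Fin.sum_univ_five]
  · simp [complexStructureFive_apply, vec_fst, vec_snd, coord_apply, lastCoord_apply]

/-! ### Decomposability, unimodularity and nilpotency -/

section Transport

variable {L L' : Type*} [LieRing L] [LieAlgebra ℝ L] [LieRing L'] [LieAlgebra ℝ L']

/-- The kernel of f is an ideal because f kills brackets, and the central line of c is a complement
to it. The vector d only witnesses that the kernel is nonzero. -/
theorem IsDecomposable.of_central (f : L →ₗ[ℝ] ℝ) (hf : ∀ x y : L, f ⁅x, y⁆ = 0) (c : L)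
    (hc : ∀ x : L, ⁅x, c⁆ = 0) (hfc : f c = 1) (d : L) (hd : d ≠ 0) (hfd : f d = 0) :
    IsDecomposable L := by
  refine ⟨{ LinearMap.ker f with lie_mem := fun {x m} _ => ?_ },
    { Submodule.span ℝ {c} with lie_mem := fun {x m} hm => ?_ }, ?_, ?_, ?_⟩
  · exact hf x m
  · obtain ⟨t, rfl⟩ := Submodule.mem_span_singleton.1 hm
    rw [lie_smul, hc, smul_zero]
    exact Submodule.zero_mem _
  · intro h
    have : d ∈ (⊥ : LieIdeal ℝ L) := h ▸ (show f d = 0 from hfd)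
    exact hd ((LieSubmodule.mem_bot d).1 this)
  · intro h
    have : c ∈ (⊥ : LieIdeal ℝ L) := h ▸ (Submodule.mem_span_singleton_self c)
    rw [(LieSubmodule.mem_bot c).1 this, map_zero] at hfc
    exact zero_ne_one hfc
  · rw [isCompl_iff, Submodule.disjoint_def, codisjoint_iff, eq_top_iff]
    refine ⟨fun x hx hx' => ?_, fun x _ => ?_⟩
    · obtain ⟨t, rfl⟩ := Submodule.mem_span_singleton.1 (show x ∈ Submodule.span ℝ {c} from hx')
      have : f (t • c) = 0 := hx
      rw [map_smul, hfc, smul_eq_mul, mul_one] at this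
      rw [this, zero_smul]
    · rw [← sub_add_cancel x (f x • c)]
      refine Submodule.add_mem_sup ?_ ?_
      · change f (x - f x • c) = 0
        simp [hfc]
      · exact Submodule.mem_span_singleton.2 ⟨_, rfl⟩

theorem isUnimodular_of_equiv (e : L ≃ₗ⁅ℝ⁆ L') (h : IsUnimodular L) : IsUnimodular L' := by
  intro X
  have h1 := h (e.symm X)
  rw [← LinearMap.trace_conj' _ e.toLinearEquiv] at h1
  have h2 := LieAlgebra.conj_ad_apply e (e.symm X)
  rw [LieEquiv.apply_symm_apply] at h2
  rw [← h2]
  exact h1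

theorem isNilpotent_of_lie_lie_lie (h : ∀ x y z : L, ⁅x, ⁅y, z⁆⁆ = 0) : LieRing.IsNilpotent L := by
  rw [LieRing.IsNilpotent, LieModule.isNilpotent_iff ℝ]
  -- The series is indexed from the whole algebra at 0, so its term 2 is [L, [L, L]].
  refine ⟨2, ?_⟩
  rw [LieModule.lowerCentralSeries_succ, LieModule.lowerCentralSeries_succ, LieSubmodule.lie_eq_bot_iff]
  intro x _ m hm
  have key : (⁅(⊤ : LieIdeal ℝ L), LieModule.lowerCentralSeries ℝ L L 0⁆ : LieSubmodule ℝ L L) ≤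
      LieModule.maxTrivSubmodule ℝ L L := by
    rw [LieSubmodule.lie_le_iff]
    intro y _ z _
    rw [LieModule.mem_maxTrivSubmodule]
    exact fun x => h x y z
  exact (LieModule.mem_maxTrivSubmodule _ _ _ m).1 (key hm) x

end Transport

/-! ### Invariants of ℝ ⋉ ℝ⁵ and isomorphisms between such algebras -/

namespace AlmostAbelianAlgebra

variable (B : Matrix (Fin 5) (Fin 5) ℝ)

theorem trace_eq_zero_of_isUnimodular (h : IsUnimodular (AlmostAbelianAlgebra B)) :
    B.trace = 0 := by
  have h1 := h ((0, 1) : (Fin 5 → ℝ) × ℝ)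
  -- The adjoint action of e₆ is B on ℝ⁵ and zero on the last factor.
  have h2 : (LieAlgebra.ad ℝ (AlmostAbelianAlgebra B) ((0, 1) : (Fin 5 → ℝ) × ℝ)) =
      (LinearMap.prodMap (Matrix.toLin' B) (0 : ℝ →ₗ[ℝ] ℝ) :
        (Fin 5 → ℝ) × ℝ →ₗ[ℝ] (Fin 5 → ℝ) × ℝ) := by
    refine LinearMap.ext fun x => Prod.ext ?_ rfl
    change (1 : ℝ) • B.mulVec x.1 - x.2 • B.mulVec 0 = B.mulVec x.1
    simp
  rw [h2] at h1
  have h3 := LinearMap.trace_prodMap' (R := ℝ) (Matrix.toLin' B) (0 : ℝ →ₗ[ℝ] ℝ)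
  rw [Matrix.trace_toLin'_eq, map_zero, add_zero] at h3
  rw [← h3]
  exact h1

theorem isNilpotent_of_sq_eq_zero (h : B * B = 0) :
    LieRing.IsNilpotent (AlmostAbelianAlgebra B) := by
  refine isNilpotent_of_lie_lie_lie fun x y z => Prod.ext ?_ rfl
  rw [bracket_fst, bracket_snd, bracket_fst]
  simp [Matrix.mulVec_sub, Matrix.mulVec_smul, Matrix.mulVec_mulVec, h]
  rfl

/-- A change of basis of the abelian ideal together with a rescaling of the last generator. -/
theorem nonempty_equiv_of_conj {B C P Q : Matrix (Fin 5) (Fin 5) ℝ} {s : ℝ} (hs : s ≠ 0)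
    (hQP : Q * P = 1) (h : B * P = s • (P * C)) :
    Nonempty (AlmostAbelianAlgebra B ≃ₗ⁅ℝ⁆ AlmostAbelianAlgebra C) := by
  have hPQ : P * Q = 1 := mul_eq_one_comm.1 hQP
  have hC : C * Q = s⁻¹ • (Q * B) := by
    have h1 : Q * (B * P) * Q = Q * (s • (P * C)) * Q := by rw [h]
    rw [mul_assoc, mul_assoc B, hPQ, mul_one, mul_smul_comm, ← mul_assoc, hQP, one_mul,
      smul_mul_assoc] at h1
    rw [h1, smul_smul, inv_mul_cancel₀ hs, one_smul]
  refine ⟨{ toFun := fun x => (Q.mulVec x.1, s * x.2)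
            invFun := fun x => (P.mulVec x.1, s⁻¹ * x.2)
            map_add' := fun x y => ?_
            map_smul' := fun c x => ?_
            map_lie' := fun {x y} => ?_
            left_inv := fun x => ?_
            right_inv := fun x => ?_ }⟩
  · exact Prod.ext (Matrix.mulVec_add Q x.1 y.1) (mul_add s x.2 y.2)
  · exact Prod.ext (Matrix.mulVec_smul Q c x.1) (mul_left_comm s c x.2)
  · refine Prod.ext ?_ (mul_zero s)
    have hQB : ∀ v, Q.mulVec (B.mulVec v) = s • C.mulVec (Q.mulVec v) := by
      intro v
      rw [Matrix.mulVec_mulVec, Matrix.mulVec_mulVec, hC, Matrix.smul_mulVec, smul_smul,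
        mul_inv_cancel₀ hs, one_smul]
    change Q.mulVec (x.2 • B.mulVec y.1 - y.2 • B.mulVec x.1) =
      (s * x.2) • C.mulVec (Q.mulVec y.1) - (s * y.2) • C.mulVec (Q.mulVec x.1)
    rw [Matrix.mulVec_sub, Matrix.mulVec_smul, Matrix.mulVec_smul, hQB, hQB, smul_smul, smul_smul,
      mul_comm, mul_comm y.2]
  · refine Prod.ext ?_ ?_
    · simp [Matrix.mulVec_mulVec, hPQ]
    · simp [hs]
  · refine Prod.ext ?_ ?_
    · simp [Matrix.mulVec_mulVec, hQP]
    · simp [hs]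

/-- A Lie algebra with a basis whose brackets are those of `ℝ ⋉_B ℝ⁵`. -/
theorem nonempty_equiv_of_basis {L : Type*} [LieRing L] [LieAlgebra ℝ L]
    (b : Module.Basis (Fin 6) ℝ L)
    (hab : ∀ i j : Fin 5, ⁅b i.castSucc, b j.castSucc⁆ = 0)
    (hB : ∀ j : Fin 5, ⁅b (Fin.last 5), b j.castSucc⁆ = ∑ i, B i j • b i.castSucc) :
    Nonempty (L ≃ₗ⁅ℝ⁆ AlmostAbelianAlgebra B) := by
  let F : AlmostAbelianAlgebra B →ₗ[ℝ] L :=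
    { toFun := fun x => ∑ i, x.1 i • b i.castSucc + x.2 • b (Fin.last 5)
      map_add' := fun x y => by
        simp only [add_fst, add_snd, Pi.add_apply, add_smul, Finset.sum_add_distrib]; abel
      map_smul' := fun c x => by
        simp only [smul_fst, smul_snd, Pi.smul_apply, smul_eq_mul, mul_smul, ← Finset.smul_sum,
          smul_add, RingHom.id_apply] }
  have hF : ∀ x, F x = ∑ i, x.1 i • b i.castSucc + x.2 • b (Fin.last 5) := fun _ => rfl
  have hT : ∀ v : Fin 5 → ℝ, ⁅b (Fin.last 5), ∑ i, v i • b i.castSucc⁆ =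
      ∑ i, (B.mulVec v) i • b i.castSucc := by
    intro v
    simp only [lie_sum, lie_smul, hB, Matrix.mulVec, dotProduct, Finset.sum_smul,
      Finset.smul_sum, smul_smul]
    rw [Finset.sum_comm]
    simp only [mul_comm]
  have hn : ∀ v w : Fin 5 → ℝ, ⁅∑ i, v i • b i.castSucc, ∑ i, w i • b i.castSucc⁆ = 0 := by
    intro v w
    simp [sum_lie, lie_sum, hab]
  have hlie : ∀ x y, F ⁅x, y⁆ = ⁅F x, F y⁆ := by
    intro x y
    rw [hF x, hF y]
    simp only [lie_add, add_lie, lie_smul, smul_lie, hn, hT, lie_self]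
    rw [← lie_skew (∑ i, x.1 i • b i.castSucc), hT, hF, bracket_fst, bracket_snd]
    simp only [Pi.sub_apply, Pi.smul_apply, sub_smul, Finset.sum_sub_distrib, smul_eq_mul,
      mul_smul, ← Finset.smul_sum]
    module
  have hbij : Function.Bijective F := by
    constructor
    · rw [← LinearMap.ker_eq_bot, LinearMap.ker_eq_bot']
      intro x hx
      have h0 : ∑ i : Fin 6, (Fin.snoc (α := fun _ => ℝ) x.1 x.2 : Fin 6 → ℝ) i • b i = 0 := by
        rw [Fin.sum_univ_castSucc]
        simp only [Fin.snoc_castSucc, Fin.snoc_last]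
        exact hx
      have h1 := Fintype.linearIndependent_iff.1 b.linearIndependent _ h0
      refine Prod.ext ?_ ?_
      · funext i
        have h2 := h1 i.castSucc
        rw [Fin.snoc_castSucc] at h2
        exact h2
      · have h2 := h1 (Fin.last 5)
        rw [Fin.snoc_last] at h2
        exact h2
    · intro y
      refine ⟨((fun i => b.repr y i.castSucc), b.repr y (Fin.last 5)), ?_⟩
      conv_rhs => rw [← b.sum_repr y, Fin.sum_univ_castSucc]
      rfl
  exact ⟨(LieEquiv.ofBijective { F with map_lie' := fun {x y} => hlie x y } hbij).symm⟩

end AlmostAbelianAlgebra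

/-! ### Orthogonality and complex eigenvectors over ℝ -/

section LinearAlgebra

variable {V : Type*} [AddCommGroup V] [Module ℝ V]

theorem exists_unit_smul {g : LinearMap.BilinForm ℝ V} (pos : ∀ x, x ≠ 0 → 0 < g x x) {x : V}
    (hx : x ≠ 0) : ∃ c : ℝ, g (c • x) (c • x) = 1 := by
  refine ⟨(√(g x x))⁻¹, ?_⟩
  have h := pos x hx
  have h1 := Real.mul_self_sqrt h.le
  have h2 : √(g x x) ≠ 0 := (Real.sqrt_pos.2 h).ne'
  simp only [map_smul, LinearMap.smul_apply, smul_eq_mul]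
  field_simp
  linarith

theorem exists_unit_orthogonal [FiniteDimensional ℝ V] {g : LinearMap.BilinForm ℝ V}
    (pos : ∀ x, x ≠ 0 → 0 < g x x) {k : ℕ} (v : Fin k → V) (hk : k < Module.finrank ℝ V) :
    ∃ x, g x x = 1 ∧ ∀ i, g (v i) x = 0 := by
  have h : (LinearMap.pi fun i => g (v i) : V →ₗ[ℝ] Fin k → ℝ).ker ≠ ⊥ :=
    LinearMap.ker_ne_bot_of_finrank_lt (by simpa using hk)
  obtain ⟨x, hx, hx0⟩ := Submodule.exists_mem_ne_zero_of_ne_bot h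
  obtain ⟨c, hc⟩ := exists_unit_smul pos hx0
  refine ⟨c • x, hc, fun i => ?_⟩
  have := congrFun (LinearMap.mem_ker.1 hx) i
  simp only [LinearMap.pi_apply, Pi.zero_apply] at this
  rw [map_smul, this, smul_zero]

/-- Riesz representation: a hyperplane is the kernel of a functional, and a positive definite form
represents every functional. -/
theorem exists_unit_normal [FiniteDimensional ℝ V] {g : LinearMap.BilinForm ℝ V}
    (pos : ∀ x, x ≠ 0 → 0 < g x x) (I : Submodule ℝ V) (hI : Module.finrank ℝ (V ⧸ I) = 1) :
    ∃ e, g e e = 1 ∧ ∀ x, x ∈ I ↔ g e x = 0 := by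
  obtain ⟨φ⟩ : Nonempty ((V ⧸ I) ≃ₗ[ℝ] ℝ) :=
    ⟨LinearEquiv.ofFinrankEq _ _ (by rw [hI, Module.finrank_self])⟩
  let f : V →ₗ[ℝ] ℝ := φ.toLinearMap ∘ₗ I.mkQ
  have hf : ∀ x, x ∈ I ↔ f x = 0 := fun x => by
    simp [f, Submodule.Quotient.mk_eq_zero]
  have hinj : Function.Injective g := by
    rw [← LinearMap.ker_eq_bot, LinearMap.ker_eq_bot']
    intro x hx
    by_contra h0
    have := pos x h0
    rw [hx] at this
    simp at this
  have hsurj : Function.Surjective g :=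
    (LinearMap.injective_iff_surjective_of_finrank_eq_finrank
      Subspace.dual_finrank_eq.symm).1 hinj
  obtain ⟨e, he⟩ := hsurj f
  have he0 : e ≠ 0 := by
    rintro rfl
    have hfz : f = 0 := by rw [← he, map_zero]
    have htop : I = ⊤ := Submodule.eq_top_iff'.2 fun x => (hf x).2 (by rw [hfz]; rfl)
    have := Submodule.Quotient.subsingleton_iff.2 htop
    rw [Module.finrank_zero_of_subsingleton] at hI
    exact zero_ne_one hI
  obtain ⟨c, hc⟩ := exists_unit_smul pos he0
  have hc0 : c ≠ 0 := by
    rintro rfl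
    simp at hc
  refine ⟨c • e, hc, fun x => ?_⟩
  rw [map_smul, LinearMap.smul_apply, he, smul_eq_mul, hf]
  simp [hc0]

/-- An endomorphism commuting with a complex structure has a complex eigenvector. -/
theorem exists_complex_eigenvector [FiniteDimensional ℝ V] [Nontrivial V] (J T : V →ₗ[ℝ] V)
    (hJ : ∀ x, J (J x) = -x) (hT : ∀ x, T (J x) = J (T x)) :
    ∃ w, w ≠ 0 ∧ ∃ r i : ℝ, T w = r • w + i • J w := by
  have hJJ : (J : Module.End ℝ V) * J = -1 := LinearMap.ext hJ
  let ρ : ℂ →ₐ[ℝ] Module.End ℝ V := Complex.lift ⟨J, hJJ⟩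
  have hρ : ∀ (c : ℂ) (x : V), ρ c x = c.re • x + c.im • J x := by
    intro c x
    simp [ρ, Complex.liftAux_apply]
  -- Letting i act as J makes V a complex space on which T is complex linear, so an eigenvalue
  -- exists.
  let : Module ℂ V := Module.compHom V ρ.toRingHom
  have hsmul : ∀ (c : ℂ) (x : V), c • x = c.re • x + c.im • J x := hρ
  have : IsScalarTower ℝ ℂ V := ⟨fun r c x => by
    simp only [hsmul, smul_add, smul_smul, Complex.real_smul, Complex.mul_re, Complex.mul_im,
      Complex.ofReal_re, Complex.ofReal_im, zero_mul, sub_zero, add_zero]⟩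
  have : FiniteDimensional ℂ V := Module.Finite.of_restrictScalars_finite ℝ ℂ V
  let T' : V →ₗ[ℂ] V :=
    { toFun := T
      map_add' := T.map_add
      map_smul' := fun c x => by
        simp only [hsmul, map_add, map_smul, hT, RingHom.id_apply] }
  obtain ⟨c, hc⟩ := Module.End.exists_eigenvalue T'
  obtain ⟨w, hw⟩ := hc.exists_hasEigenvector
  exact ⟨w, hw.2, c.re, c.im, by rw [← hsmul]; exact hw.apply_eq_smul⟩

theorem exists_orthonormal_basis [FiniteDimensional ℝ V] {g : LinearMap.BilinForm ℝ V} {n : ℕ}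
    [NeZero n] (hn : Module.finrank ℝ V = n) (v : Fin n → V)
    (hv : ∀ i j, g (v i) (v j) = if i = j then 1 else 0) :
    ∃ b : Module.Basis (Fin n) ℝ V, (∀ i, b i = v i) ∧ ∀ x, x = ∑ i, g (v i) x • v i := by
  have hlin : LinearIndependent ℝ v := by
    rw [Fintype.linearIndependent_iff]
    intro c hc i
    have := congrArg (g (v i)) hc
    simpa [hv] using this
  let b := basisOfLinearIndependentOfCardEqFinrank hlin (by simp [hn])
  have hb : ∀ i, b i = v i := fun i => by simp [b]
  refine ⟨b, hb, fun x => ?_⟩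
  have h1 : x = ∑ j, b.repr x j • v j := by
    conv_lhs => rw [← b.sum_repr x]
    simp only [hb]
  have h2 : ∀ i, g (v i) x = b.repr x i := by
    intro i
    conv_lhs => rw [h1]
    simp [hv]
  simp only [h2]
  exact h1

end LinearAlgebra

/-! ### Adapted frames of an almost abelian Hermitian algebra -/

section Frames

variable {L : Type*} [LieRing L] [LieAlgebra ℝ L]

/-- An orthonormal basis of a six-dimensional almost abelian Hermitian Lie algebra, adapted to the
abelian ideal spanned by its first five vectors, in which the complex structure has standard form
and the complex part of `ad b₅` is triangular. -/
structure AdaptedFrame (J : L →ₗ[ℝ] L) (g : LinearMap.BilinForm ℝ L) where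
  b : Module.Basis (Fin 6) ℝ L
  (lr li nr ni mr mi v0 v1 v2 v3 a : ℝ)
  orthonormal : ∀ i j, g (b i) (b j) = if i = j then 1 else 0
  J0 : J (b 0) = b 1
  J1 : J (b 1) = -b 0
  J2 : J (b 2) = b 3
  J3 : J (b 3) = -b 2
  J4 : J (b 4) = -b 5
  J5 : J (b 5) = b 4
  abelian : ∀ i j : Fin 5, ⁅b i.castSucc, b j.castSucc⁆ = 0
  lie0 : ⁅b 5, b 0⁆ = lr • b 0 + li • b 1
  lie1 : ⁅b 5, b 1⁆ = -li • b 0 + lr • b 1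
  lie2 : ⁅b 5, b 2⁆ = nr • b 0 + ni • b 1 + mr • b 2 + mi • b 3
  lie3 : ⁅b 5, b 3⁆ = -ni • b 0 + nr • b 1 - mi • b 2 + mr • b 3
  lie4 : ⁅b 5, b 4⁆ = v0 • b 0 + v1 • b 1 + v2 • b 2 + v3 • b 3 + a • b 4

theorem exists_adaptedFrame (hL : Module.finrank ℝ L = 6) (hab : IsAlmostAbelian L)
    {J : L →ₗ[ℝ] L} {g : LinearMap.BilinForm ℝ L} (h : IsHermitianStructure J g) :
    Nonempty (AdaptedFrame J g) := by
  have : FiniteDimensional ℝ L := Module.finite_of_finrank_pos (by omega)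
  obtain ⟨⟨hJ, hN⟩, hs, hp, hc⟩ := h
  obtain ⟨I, hI, hI1⟩ := hab
  have hII : ∀ x ∈ I, ∀ y ∈ I, ⁅x, y⁆ = 0 := fun x hx y hy =>
    congrArg Subtype.val (hI.trivial ⟨x, hx⟩ ⟨y, hy⟩)
  obtain ⟨e, he, heI⟩ := exists_unit_normal hp I.toSubmodule hI1
  have heI : ∀ x, x ∈ I ↔ g e x = 0 := heI
  have gJ : ∀ x, g x (J x) = 0 := by
    intro x
    have h1 := hc x (J x)
    rw [hJ, map_neg, hs (J x) x] at h1
    linarith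
  have gJ' : ∀ x y, g x (J y) = -g (J x) y := by
    intro x y
    have h1 := hc x (J y)
    rw [hJ, map_neg] at h1
    linarith
  have hJe : J e ∈ I := (heI _).2 (gJ e)
  let N : Submodule ℝ L := (g e).ker ⊓ (g (J e)).ker
  have hN_iff : ∀ x, x ∈ N ↔ g e x = 0 ∧ g (J e) x = 0 := fun x => by simp [N]
  have hNI : ∀ x ∈ N, x ∈ I := fun x hx => (heI x).2 ((hN_iff x).1 hx).1
  have hNJ : ∀ x ∈ N, J x ∈ N := by
    intro x hx
    rw [hN_iff] at hx ⊢
    rw [gJ', hx.2, hc, hx.1]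
    simp
  -- In the Nijenhuis identity for (e, x), the brackets [Je, Jx] and [Je, x] vanish since all three
  -- vectors lie in the abelian ideal.
  have hTJ : ∀ x ∈ N, ⁅e, J x⁆ = J ⁅e, x⁆ := by
    intro x hx
    have h1 := hN e x
    rw [hII _ hJe _ (hNI _ (hNJ x hx)), hII _ hJe _ (hNI x hx), map_zero] at h1
    have h2 : J ⁅e, J x⁆ = -⁅e, x⁆ := by
      rw [sub_zero, zero_sub, sub_eq_zero] at h1
      rw [← h1, neg_neg]
    have h3 := congrArg J h2
    rwa [hJ, map_neg, neg_inj] at h3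
  have hTI : ∀ x ∈ I, g e ⁅e, x⁆ = 0 := fun x hx => (heI _).1 (I.lie_mem hx)
  -- Orthogonality to Je: g(Je, [e, x]) = -g(e, J[e, x]) = -g(e, [e, Jx]), and [e, Jx] lies in the
  -- ideal.
  have hTN : ∀ x ∈ N, ⁅e, x⁆ ∈ N := by
    intro x hx
    rw [hN_iff]
    refine ⟨hTI x (hNI x hx), ?_⟩
    have h1 := gJ' e ⁅e, x⁆
    rw [← hTJ x hx, hTI _ (hNI _ (hNJ x hx))] at h1
    linarith
  obtain ⟨x₀, hx₀, hx₀'⟩ := exists_unit_orthogonal hp ![e, J e] (by omega)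
  have hx₀N : x₀ ∈ N := (hN_iff _).2 ⟨hx₀' 0, hx₀' 1⟩
  have : Nontrivial N := ⟨⟨⟨x₀, hx₀N⟩, 0, fun h0 => by
    have : x₀ = 0 := congrArg Subtype.val h0
    simp [this] at hx₀⟩⟩
  obtain ⟨w', hw', lr, li, hw'T⟩ := exists_complex_eigenvector (J.restrict hNJ)
    (LinearMap.restrict (LieAlgebra.ad ℝ L e) hTN)
    (fun x => Subtype.ext (hJ x)) (fun x => Subtype.ext (hTJ x x.2))
  obtain ⟨c, hcw⟩ := exists_unit_smul hp (x := (w' : L)) (fun h0 => hw' (Subtype.ext h0))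
  obtain ⟨w, hw⟩ : ∃ w : L, w = c • (w' : L) := ⟨_, rfl⟩
  rw [← hw] at hcw
  have hwN : w ∈ N := hw ▸ N.smul_mem c w'.2
  have hwT : ⁅e, w⁆ = lr • w + li • J w := by
    have h1 : ⁅e, (w' : L)⁆ = lr • (w' : L) + li • J w' := congrArg Subtype.val hw'T
    rw [hw, lie_smul, h1, map_smul]
    module
  -- Together u and Ju complete w and Jw to an orthonormal basis of N. The vector w is an
  -- eigenvector but u need not be, so the complex matrix is only triangular.
  obtain ⟨u, hu, hu'⟩ := exists_unit_orthogonal hp ![e, J e, w, J w] (by omega)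
  have hu0 : g e u = 0 := hu' 0
  have hu1 : g (J e) u = 0 := hu' 1
  have hu2 : g w u = 0 := hu' 2
  have hu3 : g (J w) u = 0 := hu' 3
  have huN : u ∈ N := (hN_iff _).2 ⟨hu0, hu1⟩
  obtain ⟨hw0, hw1⟩ := (hN_iff _).1 hwN
  obtain ⟨hJw0, hJw1⟩ := (hN_iff _).1 (hNJ _ hwN)
  obtain ⟨hJu0, hJu1⟩ := (hN_iff _).1 (hNJ _ huN)
  have hv : ∀ i j, g ((![w, J w, u, J u, J e, e] : Fin 6 → L) i)
      ((![w, J w, u, J u, J e, e] : Fin 6 → L) j) = if i = j then 1 else 0 := by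
    have k1 : g w (J u) = 0 := by rw [gJ', hu3, neg_zero]
    have k2 : g (J w) (J u) = 0 := by rw [hc, hu2]
    have r : ∀ {x y}, g x y = 0 → g y x = 0 := fun {x y} h => by rw [hs, h]
    intro i j
    fin_cases i <;> fin_cases j <;>
      simp [hc, he, hcw, hu, gJ, r (gJ _), hu0, hu1, hu2, hu3, hw0, hw1, hJw0, hJu0, k1, r hu0, r hu1, r hu2, r hu3, r hw0, r hw1, r hJw0, r hJu0, r k1]
  obtain ⟨b, hb, hexp⟩ := exists_orthonormal_basis hL _ hv
  obtain ⟨hTu0, hTu1⟩ := (hN_iff _).1 (hTN _ huN)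
  have hTu : ⁅e, u⁆ = g w ⁅e, u⁆ • w + g (J w) ⁅e, u⁆ • J w + g u ⁅e, u⁆ • u +
      g (J u) ⁅e, u⁆ • J u := by
    conv_lhs => rw [hexp ⁅e, u⁆]
    simp [Fin.sum_univ_six, hTu0, hTu1]
  have hTe : ⁅e, J e⁆ = g w ⁅e, J e⁆ • w + g (J w) ⁅e, J e⁆ • J w + g u ⁅e, J e⁆ • u +
      g (J u) ⁅e, J e⁆ • J u + g (J e) ⁅e, J e⁆ • J e := by
    conv_lhs => rw [hexp ⁅e, J e⁆]
    simp [Fin.sum_univ_six, hTI _ hJe]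
  have b0 : b 0 = w := hb 0
  have b1 : b 1 = J w := hb 1
  have b2 : b 2 = u := hb 2
  have b3 : b 3 = J u := hb 3
  have b4 : b 4 = J e := hb 4
  have b5 : b 5 = e := hb 5
  refine ⟨⟨b, lr, li, g w ⁅e, u⁆, g (J w) ⁅e, u⁆, g u ⁅e, u⁆, g (J u) ⁅e, u⁆, g w ⁅e, J e⁆,
    g (J w) ⁅e, J e⁆, g u ⁅e, J e⁆, g (J u) ⁅e, J e⁆, g (J e) ⁅e, J e⁆, ?_, ?_, ?_, ?_, ?_, ?_,
    ?_, ?_, ?_, ?_, ?_, ?_, ?_⟩⟩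
  · simpa only [hb] using hv
  · rw [b0, b1]
  · rw [b0, b1, hJ]
  · rw [b2, b3]
  · rw [b2, b3, hJ]
  · rw [b4, b5, hJ]
  · rw [b4, b5]
  · have hbI : ∀ i : Fin 5, b i.castSucc ∈ I := by
      intro i
      rw [heI, ← b5, hb, hb]
      refine (hv _ _).trans (if_neg ?_)
      have := i.castSucc_lt_last
      exact this.ne'
    exact fun i j => hII _ (hbI i) _ (hbI j)
  · rw [b0, b1, b5, hwT]
  · rw [b0, b1, b5, hTJ _ hwN, hwT, map_add, map_smul, map_smul, hJ]
    module
  · rw [b0, b1, b2, b3, b5]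
    exact hTu
  · rw [b0, b1, b2, b3, b5, hTJ _ huN]
    conv_lhs => rw [hTu]
    simp only [map_add, map_smul, hJ]
    module
  · rw [b0, b1, b2, b3, b4, b5]
    exact hTe

end Frames

/-! ### The SKT and holomorphy conditions in an adapted frame -/

namespace AdaptedFrame

variable {L : Type*} [LieRing L] [LieAlgebra ℝ L] {J : L →ₗ[ℝ] L} {g : LinearMap.BilinForm ℝ L}

theorem lie_eq_zero (F : AdaptedFrame J g) (i j : Fin 6) (hi : i ≠ 5) (hj : j ≠ 5) :
    ⁅F.b i, F.b j⁆ = 0 := by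
  have h := F.abelian (i.castPred hi) (j.castPred hj)
  rwa [Fin.castSucc_castPred, Fin.castSucc_castPred] at h

theorem lie_swap (F : AdaptedFrame J g) (i : Fin 6) : ⁅F.b i, F.b 5⁆ = -⁅F.b 5, F.b i⁆ :=
  (lie_skew _ _).symm

/-- Each equation is one value of dd^cω on b₅, b₄ and two vectors of N. With λ, μ, ν the complex
numbers built from (`lr`, `li`), (`mr`, `mi`), (`nr`, `ni`), the last two are the imaginary and real
parts of (a + 3 Re λ + Re μ + i Im(μ - λ)) ν = 0. -/
theorem skt_equations (F : AdaptedFrame J g)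
    (hd : ∀ X Y Z W, extDerivThree (dcTwo J (fundamentalForm J g)) X Y Z W = 0) :
    F.lr * (F.a + 2 * F.lr) = 0 ∧
    F.mr * (F.a + 2 * F.mr) + F.nr ^ 2 + F.ni ^ 2 = 0 ∧
    (F.a + 3 * F.lr + F.mr) * F.ni + (F.mi - F.li) * F.nr = 0 ∧
    (F.a + 3 * F.lr + F.mr) * F.nr - (F.mi - F.li) * F.ni = 0 := by
  have A := F.lie_eq_zero
  have h1 := hd (F.b 5) (F.b 4) (F.b 0) (F.b 1)
  have h2 := hd (F.b 5) (F.b 4) (F.b 2) (F.b 3)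
  have h3 := hd (F.b 5) (F.b 4) (F.b 0) (F.b 2)
  have h4 := hd (F.b 5) (F.b 4) (F.b 0) (F.b 3)
  have S0 := F.lie_swap 0
  have S1 := F.lie_swap 1
  have S2 := F.lie_swap 2
  have S3 := F.lie_swap 3
  have S4 := F.lie_swap 4
  simp [extDerivThree, dcTwo, extDerivTwo, fundamentalForm, F.J0, F.J1, F.J2, F.J3, F.J4, F.J5,
    F.lie0, F.lie1, F.lie2, F.lie3, F.lie4, A, F.orthonormal, S0, S1, S2, S3, S4] at h1 h2 h3 h4
  exact ⟨by linear_combination h1 / 2, by linear_combination h2 / 2, by linear_combination h3,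
    by linear_combination h4⟩

/-- In an SKT Lie algebra, the complex part of `ad b₅` is diagonal and its eigenvalues have real
part `0` or `-a / 2`. -/
theorem diagonal_of_skt (F : AdaptedFrame J g) (h : IsSKT J g) :
    F.nr = 0 ∧ F.ni = 0 ∧ (F.lr = 0 ∨ F.a + 2 * F.lr = 0) ∧ (F.mr = 0 ∨ F.a + 2 * F.mr = 0) := by
  obtain ⟨h1, h2, h3, h4⟩ := F.skt_equations h.2
  -- Multiply the complex equation by the conjugate of ν and take the real part.
  have h5 : (F.a + 3 * F.lr + F.mr) * (F.nr ^ 2 + F.ni ^ 2) = 0 := by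
    linear_combination F.ni * h3 + F.nr * h4
  have hl := mul_eq_zero.1 h1
  -- If the other factor vanishes, then Re μ is -a or a/2 according to the value of Re λ. Either way
  -- Re μ (a + 2 Re μ) = a², and the second SKT equation becomes a² + |ν|² = 0.
  have h6 : F.nr ^ 2 + F.ni ^ 2 = 0 := by
    rcases mul_eq_zero.1 h5 with h5 | h5
    · rcases hl with hl | hl
      · have : F.mr = -F.a := by linarith
        rw [this] at h2
        nlinarith [sq_nonneg F.a, sq_nonneg F.nr, sq_nonneg F.ni]
      · have : F.mr = F.a / 2 := by linarith
        rw [this] at h2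
        nlinarith [sq_nonneg F.a, sq_nonneg F.nr, sq_nonneg F.ni]
    · exact h5
  have h7 : F.nr = 0 := by nlinarith [sq_nonneg F.nr, sq_nonneg F.ni]
  have h8 : F.ni = 0 := by nlinarith [sq_nonneg F.nr, sq_nonneg F.ni]
  refine ⟨h7, h8, hl, mul_eq_zero.1 ?_⟩
  rw [h7, h8] at h2
  linarith

theorem exists_holVec_eq (F : AdaptedFrame J g) (hJ : ∀ x, J (J x) = -x) (y : L) :
    ∃ α β γ : ℂ, holVec J y = α • holVec J (F.b 0) + β • holVec J (F.b 2) +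
      γ • holVec J (F.b 5) := by
  -- The last pair is reversed: b₄ = J b₅, while b₁ = J b₀ and b₃ = J b₂.
  refine ⟨F.b.repr y 0 + F.b.repr y 1 * Complex.I, F.b.repr y 2 + F.b.repr y 3 * Complex.I,
    F.b.repr y 5 + F.b.repr y 4 * Complex.I, ?_⟩
  conv_lhs => rw [← F.b.sum_repr y, Fin.sum_univ_six, ← F.J0, ← F.J2, ← F.J5]
  simp only [holVec_add, holVec_smul, holVec_J hJ]
  module

theorem exists_bivector_eq (F : AdaptedFrame J g) (hJ : ∀ x, J (J x) = -x)
    {P : ⋀[ℂ]^2 (ℂ ⊗[ℝ] L)} (hP : P ∈ bivectorsTwoZero J) :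
    ∃ p q r : ℂ, P = p • wedge (holVec J (F.b 0)) (holVec J (F.b 2)) +
      q • wedge (holVec J (F.b 0)) (holVec J (F.b 5)) +
      r • wedge (holVec J (F.b 2)) (holVec J (F.b 5)) := by
  induction hP using Submodule.span_induction with
  | mem P hP =>
    obtain ⟨Y, hY, Z, hZ, rfl⟩ := hP
    obtain ⟨y, rfl⟩ := exists_holVec hJ hY
    obtain ⟨z, rfl⟩ := exists_holVec hJ hZ
    obtain ⟨α, β, γ, hy⟩ := F.exists_holVec_eq hJ y
    obtain ⟨α', β', γ', hz⟩ := F.exists_holVec_eq hJ z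
    refine ⟨α * β' - β * α', α * γ' - γ * α', β * γ' - γ * β', ?_⟩
    rw [hy, hz]
    simp only [wedge_add_left, wedge_add_right, wedge_smul_left, wedge_smul_right, wedge_self,
      wedge_swap (holVec J (F.b 0)) (holVec J (F.b 2)),
      wedge_swap (holVec J (F.b 0)) (holVec J (F.b 5)),
      wedge_swap (holVec J (F.b 2)) (holVec J (F.b 5))]
    module
  | zero => exact ⟨0, 0, 0, by simp⟩
  | add P Q _ _ hP hQ =>
    obtain ⟨p, q, r, rfl⟩ := hP
    obtain ⟨p', q', r', rfl⟩ := hQ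
    exact ⟨p + p', q + q', r + r', by module⟩
  | smul c P _ hP =>
    obtain ⟨p, q, r, rfl⟩ := hP
    exact ⟨c * p, c * q, c * r, by module⟩

/-- A nonzero holomorphic (2,0)-vector forces a resonance among the eigenvalues of the
Cauchy-Riemann operator. -/
theorem resonance (F : AdaptedFrame J g) (hJ : ∀ x, J (J x) = -x) (hnr : F.nr = 0)
    (hni : F.ni = 0) {P : ⋀[ℂ]^2 (ℂ ⊗[ℝ] L)} (hP0 : P ≠ 0) (hP : P ∈ bivectorsTwoZero J)
    (hol : ∀ X ∈ antiholomorphicPart J, leibnizTwo (delbar J X) P = 0) :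
    (F.lr + F.mr = 0 ∧ F.li + F.mi = 0) ∨ (F.lr + F.a = 0 ∧ F.li = 0) ∨
      (F.mr + F.a = 0 ∧ F.mi = 0) := by
  obtain ⟨p, q, r, rfl⟩ := F.exists_bivector_eq hJ hP
  -- The single direction b₅ already gives the resonance.
  have h := hol _ (antiVec_mem hJ (F.b 5))
  have A := F.lie_eq_zero
  have S4 := F.lie_swap 4
  have c0 : crReal J (F.b 5) (F.b 0) = F.lr • F.b 0 + F.li • J (F.b 0) := by
    simp only [crReal, F.J5, F.J0, A 4 1 (by decide) (by decide), A 4 0 (by decide) (by decide),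
      F.lie0, F.lie1, map_add, map_smul, F.J1, map_zero]
    module
  have c2 : crReal J (F.b 5) (F.b 2) = F.mr • F.b 2 + F.mi • J (F.b 2) := by
    simp only [crReal, F.J5, F.J2, A 4 3 (by decide) (by decide), A 4 2 (by decide) (by decide),
      F.lie2, F.lie3, map_add, map_smul, map_sub, F.J3, map_zero, hnr, hni]
    module
  have c5 : crReal J (F.b 5) (F.b 5) = F.a • F.b 5 - F.v0 • J (F.b 0) + F.v1 • F.b 0 -
      F.v2 • J (F.b 2) + F.v3 • F.b 2 := by
    simp only [crReal, F.J5, S4, lie_self, F.lie4, map_add, map_smul, map_neg, F.J0, F.J1, F.J2,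
      F.J3, F.J4]
    module
  simp only [map_add, map_smul, leibnizTwo_wedge, delbar_antiVec_holVec hJ, c0, c2, c5,
    sub_eq_add_neg, ← neg_smul, holVec_add, holVec_smul, holVec_J hJ] at h
  have e02 := congrArg (pairFunctional (complexFunctional (F.b.coord 0))
    (complexFunctional (F.b.coord 2))) h
  have e05 := congrArg (pairFunctional (complexFunctional (F.b.coord 0))
    (complexFunctional (F.b.coord 5))) h
  have e25 := congrArg (pairFunctional (complexFunctional (F.b.coord 2))
    (complexFunctional (F.b.coord 5))) h
  simp [pairFunctional_mul, complexFunctional_holVec, F.J0, F.J2, F.J5, add_mul, mul_add]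
    at e02 e05 e25
  -- The vector v mixes the 05 and 25 components into the 02 component but not conversely. So q and
  -- r are treated first, and the 02 equation is used only once both vanish.
  have k05 : q * ((F.lr + F.li * Complex.I) + F.a) = 0 := by linear_combination e05
  have k25 : r * ((F.mr + F.mi * Complex.I) + F.a) = 0 := by linear_combination e25
  have hC : ∀ x y : ℝ, (x + y * Complex.I : ℂ) = 0 → x = 0 ∧ y = 0 := by
    intro x y hxy
    exact ⟨by simpa using congrArg Complex.re hxy, by simpa using congrArg Complex.im hxy⟩
  rcases mul_eq_zero.1 k05 with hq | hq
  · rcases mul_eq_zero.1 k25 with hr | hr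
    · have k02 : p * ((F.lr + F.li * Complex.I) + (F.mr + F.mi * Complex.I)) = 0 := by
        rw [hq, hr] at e02
        linear_combination e02
      rcases mul_eq_zero.1 k02 with hp | hp
      · exact absurd (by simp [hp, hq, hr]) hP0
      · refine Or.inl (hC _ _ ?_)
        push_cast
        linear_combination hp
    · refine Or.inr (Or.inr (hC _ _ ?_))
      push_cast
      linear_combination hr
  · refine Or.inr (Or.inl (hC _ _ ?_))
    push_cast
    linear_combination hq

end AdaptedFrame

/-! ### Normal forms of the frame matrix -/

namespace AlmostAbelianAlgebra

/-- The matrix of an adapted frame whose complex eigenvalues are `i t` and `i s`. -/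
abbrev frameMatrix (t s v0 v1 v2 v3 a : ℝ) : Matrix (Fin 5) (Fin 5) ℝ :=
  !![0, -t, 0, 0, v0; t, 0, 0, 0, v1; 0, 0, 0, -s, v2; 0, 0, s, 0, v3; 0, 0, 0, 0, a]

/-- The vector (z0, z1, z2, z3, 1) is an eigenvector for a; solving for it inverts the rotation
blocks minus a, whence the denominator t² + a². The planes rotate in opposite senses, so one basis
vector changes sign, and dividing by t normalises the speed. -/
theorem frameMatrix_equiv_K11 {t a : ℝ} (ht : t ≠ 0) (v0 v1 v2 v3 : ℝ) :
    Nonempty (AlmostAbelianAlgebra (frameMatrix t (-t) v0 v1 v2 v3 a) ≃ₗ⁅ℝ⁆ K11 (a / t) 0 0 1) := by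
  have hn : t ^ 2 + a ^ 2 ≠ 0 := by positivity
  obtain ⟨z0, h0⟩ : ∃ z, z = (a * v0 - t * v1) / (t ^ 2 + a ^ 2) := ⟨_, rfl⟩
  obtain ⟨z1, h1⟩ : ∃ z, z = (a * v1 + t * v0) / (t ^ 2 + a ^ 2) := ⟨_, rfl⟩
  obtain ⟨z2, h2⟩ : ∃ z, z = (a * v2 + t * v3) / (t ^ 2 + a ^ 2) := ⟨_, rfl⟩
  obtain ⟨z3, h3⟩ : ∃ z, z = (a * v3 - t * v2) / (t ^ 2 + a ^ 2) := ⟨_, rfl⟩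
  refine nonempty_equiv_of_conj (s := t)
    (P := !![z0, 1, 0, 0, 0; z1, 0, -1, 0, 0; z2, 0, 0, 1, 0; z3, 0, 0, 0, 1; 1, 0, 0, 0, 0])
    (Q := !![0, 0, 0, 0, 1; 1, 0, 0, 0, -z0; 0, -1, 0, 0, z1; 0, 0, 1, 0, -z2; 0, 0, 0, 1, -z3])
    ht ?_ ?_
  · ext i j
    fin_cases i <;> fin_cases j <;> simp [Matrix.mul_apply, Fin.sum_univ_five]
  · ext i j
    fin_cases i <;> fin_cases j <;> simp [Matrix.mul_apply, Fin.sum_univ_five, h0, h1, h2, h3] <;>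
      field_simp <;> ring

/-- With a = 0 the rotation blocks are invertible, so the last basis vector can be corrected to lie
in the kernel. -/
theorem frameMatrix_equiv_K25 {t : ℝ} (ht : t ≠ 0) (v0 v1 v2 v3 : ℝ) :
    Nonempty (AlmostAbelianAlgebra (frameMatrix t (-t) v0 v1 v2 v3 0) ≃ₗ⁅ℝ⁆ K25 0 0 1) := by
  refine nonempty_equiv_of_conj (s := t)
    (P := !![1, 0, 0, 0, -v1 / t; 0, -1, 0, 0, v0 / t; 0, 0, 1, 0, v3 / t; 0, 0, 0, 1, -v2 / t;
      0, 0, 0, 0, 1])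
    (Q := !![1, 0, 0, 0, v1 / t; 0, -1, 0, 0, v0 / t; 0, 0, 1, 0, -v3 / t; 0, 0, 0, 1, v2 / t;
      0, 0, 0, 0, 1])
    ht ?_ ?_
  · ext i j
    fin_cases i <;> fin_cases j <;> simp [Matrix.mul_apply, Fin.sum_univ_five] <;> ring
  · ext i j
    fin_cases i <;> fin_cases j <;> simp [Matrix.mul_apply, Fin.sum_univ_five] <;>
      field_simp <;> ring

/-- The matrix has rank one: its last column is an eigenvector for a, and the first four basis
vectors span the kernel. -/
theorem frameMatrix_equiv_K13 {a : ℝ} (ha : a ≠ 0) (v0 v1 v2 v3 : ℝ) :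
    Nonempty (AlmostAbelianAlgebra (frameMatrix 0 0 v0 v1 v2 v3 a) ≃ₗ⁅ℝ⁆ K13) := by
  refine nonempty_equiv_of_conj (s := a)
    (P := !![v0 / a, 1, 0, 0, 0; v1 / a, 0, 1, 0, 0; v2 / a, 0, 0, 1, 0; v3 / a, 0, 0, 0, 1;
      1, 0, 0, 0, 0])
    (Q := !![0, 0, 0, 0, 1; 1, 0, 0, 0, -v0 / a; 0, 1, 0, 0, -v1 / a; 0, 0, 1, 0, -v2 / a;
      0, 0, 0, 1, -v3 / a])
    ha ?_ ?_
  · ext i j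
    fin_cases i <;> fin_cases j <;> simp [Matrix.mul_apply, Fin.sum_univ_five] <;> ring
  · ext i j
    fin_cases i <;> fin_cases j <;> simp [Matrix.mul_apply, Fin.sum_univ_five] <;>
      field_simp

theorem frameMatrix_equiv_K15 {s : ℝ} (hs : s ≠ 0) (v2 v3 : ℝ) :
    Nonempty (AlmostAbelianAlgebra (frameMatrix 0 s 0 0 v2 v3 0) ≃ₗ⁅ℝ⁆ K15 0) := by
  refine nonempty_equiv_of_conj (s := s)
    (P := !![0, 0, 1, 0, 0; 0, 0, 0, 1, 0; 1, 0, 0, 0, -v3 / s; 0, -1, 0, 0, v2 / s; 0, 0, 0, 0, 1])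
    (Q := !![0, 0, 1, 0, v3 / s; 0, 0, 0, -1, v2 / s; 1, 0, 0, 0, 0; 0, 1, 0, 0, 0; 0, 0, 0, 0, 1])
    hs ?_ ?_
  · ext i j
    fin_cases i <;> fin_cases j <;> simp [Matrix.mul_apply, Fin.sum_univ_five] <;> ring
  · ext i j
    fin_cases i <;> fin_cases j <;> simp [Matrix.mul_apply, Fin.sum_univ_five] <;>
      field_simp <;> ring

/-- The rotating plane comes first. The fourth column of P is the last basis vector with v2, v3
removed; it is mapped to (v0, v1) in the kernel, giving a Jordan block. The fifth column is (v0, v1)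
turned by a right angle, the remaining kernel direction. -/
theorem frameMatrix_equiv_K23 {s v0 v1 : ℝ} (hs : s ≠ 0) (hv : v0 ^ 2 + v1 ^ 2 ≠ 0) (v2 v3 : ℝ) :
    Nonempty (AlmostAbelianAlgebra (frameMatrix 0 s v0 v1 v2 v3 0) ≃ₗ⁅ℝ⁆ K23 0) := by
  obtain ⟨n, hn⟩ : ∃ n, n = v0 ^ 2 + v1 ^ 2 := ⟨_, rfl⟩
  rw [← hn] at hv
  refine nonempty_equiv_of_conj (s := s)
    (P := !![0, 0, v0 / s, 0, -v1; 0, 0, v1 / s, 0, v0; 1, 0, 0, -v3 / s, 0; 0, -1, 0, v2 / s, 0;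
      0, 0, 0, 1, 0])
    (Q := !![0, 0, 1, 0, v3 / s; 0, 0, 0, -1, v2 / s; s * v0 / n, s * v1 / n, 0, 0, 0;
      0, 0, 0, 0, 1; -v1 / n, v0 / n, 0, 0, 0])
    hs ?_ ?_
  · ext i j
    fin_cases i <;> fin_cases j <;> simp [Matrix.mul_apply, Fin.sum_univ_five] <;>
      (field_simp; linarith)
  · ext i j
    fin_cases i <;> fin_cases j <;> simp [Matrix.mul_apply, Fin.sum_univ_five] <;>
      field_simp <;> ring

theorem frameMatrix_equiv_swap (t s v0 v1 v2 v3 a : ℝ) :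
    Nonempty (AlmostAbelianAlgebra (frameMatrix t s v0 v1 v2 v3 a) ≃ₗ⁅ℝ⁆
      AlmostAbelianAlgebra (frameMatrix s t v2 v3 v0 v1 a)) := by
  refine nonempty_equiv_of_conj (s := 1)
    (P := !![0, 0, 1, 0, 0; 0, 0, 0, 1, 0; 1, 0, 0, 0, 0; 0, 1, 0, 0, 0; 0, 0, 0, 0, 1])
    (Q := !![0, 0, 1, 0, 0; 0, 0, 0, 1, 0; 1, 0, 0, 0, 0; 0, 1, 0, 0, 0; 0, 0, 0, 0, 1])
    one_ne_zero ?_ ?_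
  · ext i j
    fin_cases i <;> fin_cases j <;> simp [Matrix.mul_apply, Fin.sum_univ_five]
  · ext i j
    fin_cases i <;> fin_cases j <;> simp [Matrix.mul_apply, Fin.sum_univ_five]

theorem frameMatrix_isNilpotent (v0 v1 v2 v3 : ℝ) :
    LieRing.IsNilpotent (AlmostAbelianAlgebra (frameMatrix 0 0 v0 v1 v2 v3 0)) := by
  refine isNilpotent_of_sq_eq_zero _ ?_
  ext i j
  fin_cases i <;> fin_cases j <;> simp [Matrix.mul_apply, Fin.sum_univ_five]

theorem frameMatrix_equiv_K15_or_K23 {s : ℝ} (hs : s ≠ 0) (v0 v1 v2 v3 : ℝ) :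
    Nonempty (AlmostAbelianAlgebra (frameMatrix 0 s v0 v1 v2 v3 0) ≃ₗ⁅ℝ⁆ K15 0) ∨
      Nonempty (AlmostAbelianAlgebra (frameMatrix 0 s v0 v1 v2 v3 0) ≃ₗ⁅ℝ⁆ K23 0) := by
  by_cases hv : v0 ^ 2 + v1 ^ 2 = 0
  · have h0 : v0 = 0 := by nlinarith [sq_nonneg v0, sq_nonneg v1]
    have h1 : v1 = 0 := by nlinarith [sq_nonneg v0, sq_nonneg v1]
    subst h0 h1
    exact Or.inl (frameMatrix_equiv_K15 hs v2 v3)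
  · exact Or.inr (frameMatrix_equiv_K23 hs hv v2 v3)

end AlmostAbelianAlgebra

/-! ### Classification and the unimodular case -/

section Classification

open AlmostAbelianAlgebra

variable {L : Type*} [LieRing L] [LieAlgebra ℝ L]

theorem AdaptedFrame.nonempty_equiv {J : L →ₗ[ℝ] L} {g : LinearMap.BilinForm ℝ L}
    (F : AdaptedFrame J g) (hnr : F.nr = 0) (hni : F.ni = 0) (hlr : F.lr = 0) (hmr : F.mr = 0) :
    Nonempty (L ≃ₗ⁅ℝ⁆
      AlmostAbelianAlgebra (frameMatrix F.li F.mi F.v0 F.v1 F.v2 F.v3 F.a)) := by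
  refine nonempty_equiv_of_basis _ F.b F.abelian fun j => ?_
  have h0 := F.lie0
  have h1 := F.lie1
  have h2 := F.lie2
  have h3 := F.lie3
  have h4 := F.lie4
  simp only [hnr, hni, hlr, hmr, neg_zero, zero_smul, zero_add, add_zero, zero_sub] at h0 h1 h2 h3
  rw [Fin.sum_univ_five]
  fin_cases j
  · simpa using h0
  · simpa using h1
  · simpa using h2
  · simpa using h3
  · simpa using h4

theorem classification (hL : Module.finrank ℝ L = 6) (hab : IsAlmostAbelian L)
    (hnil : ¬ LieRing.IsNilpotent L) (h : AdmitsSKTWithHolomorphicPoisson L) :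
    (∃ p : ℝ, p ≠ 0 ∧ Nonempty (L ≃ₗ⁅ℝ⁆ K11 p 0 0 1)) ∨ Nonempty (L ≃ₗ⁅ℝ⁆ K13) ∨
      Nonempty (L ≃ₗ⁅ℝ⁆ K15 0) ∨ Nonempty (L ≃ₗ⁅ℝ⁆ K23 0) ∨ Nonempty (L ≃ₗ⁅ℝ⁆ K25 0 0 1) := by
  obtain ⟨J, g, hS, P, hP0, hP⟩ := h
  obtain ⟨F⟩ := exists_adaptedFrame hL hab hS.1
  obtain ⟨hnr, hni, hl, hm⟩ := F.diagonal_of_skt hS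
  have hres := F.resonance hS.1.complex.sq hnr hni hP0 hP.type_two_zero hP.holomorphic
  -- Real parts in {0, -a/2} have the same sign, so they can only cancel if both vanish; and a real
  -- part equal to -a forces a = 0.
  have key : F.lr = 0 ∧ F.mr = 0 ∧
      (F.mi = -F.li ∨ (F.a = 0 ∧ F.li = 0) ∨ (F.a = 0 ∧ F.mi = 0)) := by
    rcases hres with ⟨h1, h2⟩ | ⟨h1, h2⟩ | ⟨h1, h2⟩
    · refine ⟨?_, ?_, Or.inl (by linarith)⟩ <;> rcases hl with hl | hl <;>
        rcases hm with hm | hm <;> linarith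
    · have ha : F.a = 0 := by rcases hl with hl | hl <;> linarith
      refine ⟨by linarith, ?_, Or.inr (Or.inl ⟨ha, h2⟩)⟩
      rcases hm with hm | hm <;> linarith
    · have ha : F.a = 0 := by rcases hm with hm | hm <;> linarith
      refine ⟨?_, by linarith, Or.inr (Or.inr ⟨ha, h2⟩)⟩
      rcases hl with hl | hl <;> linarith
  obtain ⟨hlr, hmr, hcases⟩ := key
  obtain ⟨e⟩ := F.nonempty_equiv hnr hni hlr hmr
  generalize F.li = t at *
  generalize F.mi = s at *
  generalize F.a = a at *
  -- In this case the matrix squares to zero and the algebra is nilpotent.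
  by_cases hts : a = 0 ∧ t = 0 ∧ s = 0
  · obtain ⟨rfl, rfl, rfl⟩ := hts
    exact absurd ((LieEquiv.nilpotent_iff_equiv_nilpotent e).2 (frameMatrix_isNilpotent _ _ _ _)) hnil
  rcases hcases with rfl | ⟨rfl, rfl⟩ | ⟨rfl, rfl⟩
  · by_cases ht : t = 0
    · subst ht
      have ha : a ≠ 0 := fun ha => hts ⟨ha, rfl, neg_zero⟩
      rw [neg_zero] at e
      obtain ⟨e'⟩ := frameMatrix_equiv_K13 ha F.v0 F.v1 F.v2 F.v3
      exact Or.inr (Or.inl ⟨e.trans e'⟩)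
    · by_cases ha : a = 0
      · subst ha
        obtain ⟨e'⟩ := frameMatrix_equiv_K25 ht F.v0 F.v1 F.v2 F.v3
        exact Or.inr (Or.inr (Or.inr (Or.inr ⟨e.trans e'⟩)))
      · obtain ⟨e'⟩ := frameMatrix_equiv_K11 (a := a) ht F.v0 F.v1 F.v2 F.v3
        exact Or.inl ⟨a / t, div_ne_zero ha ht, ⟨e.trans e'⟩⟩
  · have hs : s ≠ 0 := fun hs => hts ⟨rfl, rfl, hs⟩
    rcases frameMatrix_equiv_K15_or_K23 hs F.v0 F.v1 F.v2 F.v3 with ⟨⟨e'⟩⟩ | ⟨⟨e'⟩⟩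
    · exact Or.inr (Or.inr (Or.inl ⟨e.trans e'⟩))
    · exact Or.inr (Or.inr (Or.inr (Or.inl ⟨e.trans e'⟩)))
  · have ht : t ≠ 0 := fun ht => hts ⟨rfl, ht, rfl⟩
    -- Exchanging the two planes reduces to the previous case.
    obtain ⟨e₁⟩ := frameMatrix_equiv_swap t 0 F.v0 F.v1 F.v2 F.v3 0
    rcases frameMatrix_equiv_K15_or_K23 ht F.v2 F.v3 F.v0 F.v1 with ⟨⟨e'⟩⟩ | ⟨⟨e'⟩⟩
    · exact Or.inr (Or.inr (Or.inl ⟨(e.trans e₁).trans e'⟩))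
    · exact Or.inr (Or.inr (Or.inr (Or.inl ⟨(e.trans e₁).trans e'⟩)))

theorem admits_of_classification
    (h : (∃ p : ℝ, p ≠ 0 ∧ Nonempty (L ≃ₗ⁅ℝ⁆ K11 p 0 0 1)) ∨ Nonempty (L ≃ₗ⁅ℝ⁆ K13) ∨
      Nonempty (L ≃ₗ⁅ℝ⁆ K15 0) ∨ Nonempty (L ≃ₗ⁅ℝ⁆ K23 0) ∨ Nonempty (L ≃ₗ⁅ℝ⁆ K25 0 0 1)) :
    AdmitsSKTWithHolomorphicPoisson L := by
  rcases h with ⟨p, -, ⟨e⟩⟩ | ⟨⟨e⟩⟩ | ⟨⟨e⟩⟩ | ⟨⟨e⟩⟩ | ⟨⟨e⟩⟩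
  · exact ((K11.admits p).of_equiv e).admits
  · exact (K13.admits.of_equiv e).admits
  · exact (K15.admits.of_equiv e).admits
  · exact (K23.admits.of_equiv e).admits
  · exact (K25.admits.of_equiv e).admits

/-- If the fifth row and the fifth column of `B` vanish, then `e₅` splits off. -/
theorem isDecomposable_of_equiv {B : Matrix (Fin 5) (Fin 5) ℝ} (e : L ≃ₗ⁅ℝ⁆ AlmostAbelianAlgebra B)
    (hrow : ∀ j, B 4 j = 0) (hcol : ∀ i, B i 4 = 0) : IsDecomposable L := by
  have hlie : ∀ x y, e ⁅x, y⁆ = ⁅e x, e y⁆ := fun x y => e.toLieHom.map_lie x y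
  refine IsDecomposable.of_central (coord B 4 ∘ₗ e.toLinearEquiv.toLinearMap) ?_
    (e.symm (vec B 0 0 0 0 1 0)) ?_ ?_ (e.symm (vec B 1 0 0 0 0 0)) ?_ ?_
  · intro x y
    change (e ⁅x, y⁆).1 4 = 0
    rw [hlie, lie_coord]
    simp [hrow]
  · intro x
    apply e.injective
    change e ⁅x, e.symm (vec B 0 0 0 0 1 0)⁆ = e 0
    rw [hlie, LieEquiv.apply_symm_apply, map_zero]
    have h : ∀ i, ⁅e x, vec B 0 0 0 0 1 0⁆.1 i = 0 := fun i => by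
      rw [lie_coord]
      simp [vec_fst, vec_snd, Fin.sum_univ_five, hcol]
    exact ext_coord (h 0) (h 1) (h 2) (h 3) (h 4) rfl
  · change (e (e.symm (vec B 0 0 0 0 1 0))).1 4 = 1
    rw [LieEquiv.apply_symm_apply]
    rfl
  · intro h0
    have h1 := congrArg (fun x => (e x).1 0) h0
    simp only [LieEquiv.apply_symm_apply, map_zero] at h1
    exact one_ne_zero h1
  · change (e (e.symm (vec B 1 0 0 0 0 0))).1 4 = 0
    rw [LieEquiv.apply_symm_apply]
    rfl

theorem unimodular_classification
    (h : (∃ p : ℝ, p ≠ 0 ∧ Nonempty (L ≃ₗ⁅ℝ⁆ K11 p 0 0 1)) ∨ Nonempty (L ≃ₗ⁅ℝ⁆ K13) ∨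
      Nonempty (L ≃ₗ⁅ℝ⁆ K15 0) ∨ Nonempty (L ≃ₗ⁅ℝ⁆ K23 0) ∨ Nonempty (L ≃ₗ⁅ℝ⁆ K25 0 0 1))
    (hu : IsUnimodular L) : IsDecomposable L ∧ (Nonempty (L ≃ₗ⁅ℝ⁆ K15 0) ∨
      Nonempty (L ≃ₗ⁅ℝ⁆ K23 0) ∨ Nonempty (L ≃ₗ⁅ℝ⁆ K25 0 0 1)) := by
  rcases h with ⟨p, hp, ⟨e⟩⟩ | ⟨⟨e⟩⟩ | ⟨⟨e⟩⟩ | ⟨⟨e⟩⟩ | ⟨⟨e⟩⟩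
  · have := trace_eq_zero_of_isUnimodular _ (isUnimodular_of_equiv e hu)
    simp [Matrix.trace, Fin.sum_univ_five] at this
    exact absurd this hp
  · have := trace_eq_zero_of_isUnimodular _ (isUnimodular_of_equiv e hu)
    simp [Matrix.trace, Fin.sum_univ_five] at this
  · refine ⟨isDecomposable_of_equiv e ?_ ?_, Or.inl ⟨e⟩⟩ <;> intro i <;> fin_cases i <;> rfl
  · refine ⟨isDecomposable_of_equiv e ?_ ?_, Or.inr (Or.inl ⟨e⟩)⟩ <;> intro i <;>
      fin_cases i <;> rfl
  · refine ⟨isDecomposable_of_equiv e ?_ ?_, Or.inr (Or.inr ⟨e⟩)⟩ <;> intro i <;>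
      fin_cases i <;> rfl

end Classification

theorem theorem4p1
    {G : Type*} [TopologicalSpace G] [ChartedSpace (EuclideanSpace ℝ (Fin 6)) G] [Group G]
    [LieGroup (𝓡 6) ∞ G] [SimplyConnectedSpace G]
    (hab : IsAlmostAbelian (GroupLieAlgebra (𝓡 6) G))
    (hnil : ¬ LieRing.IsNilpotent (GroupLieAlgebra (𝓡 6) G)) :
    (AdmitsSKTWithHolomorphicPoisson (GroupLieAlgebra (𝓡 6) G) ↔
      (∃ p : ℝ, p ≠ 0 ∧ Nonempty (GroupLieAlgebra (𝓡 6) G ≃ₗ⁅ℝ⁆ K11 p 0 0 1)) ∨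
      Nonempty (GroupLieAlgebra (𝓡 6) G ≃ₗ⁅ℝ⁆ K13) ∨
      Nonempty (GroupLieAlgebra (𝓡 6) G ≃ₗ⁅ℝ⁆ K15 0) ∨
      Nonempty (GroupLieAlgebra (𝓡 6) G ≃ₗ⁅ℝ⁆ K23 0) ∨
      Nonempty (GroupLieAlgebra (𝓡 6) G ≃ₗ⁅ℝ⁆ K25 0 0 1)) ∧
    (AdmitsSKTWithHolomorphicPoisson (GroupLieAlgebra (𝓡 6) G) →
      IsUnimodular (GroupLieAlgebra (𝓡 6) G) →
      IsDecomposable (GroupLieAlgebra (𝓡 6) G) ∧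
      (Nonempty (GroupLieAlgebra (𝓡 6) G ≃ₗ⁅ℝ⁆ K15 0) ∨
        Nonempty (GroupLieAlgebra (𝓡 6) G ≃ₗ⁅ℝ⁆ K23 0) ∨
        Nonempty (GroupLieAlgebra (𝓡 6) G ≃ₗ⁅ℝ⁆ K25 0 0 1))) := by
  have hL : Module.finrank ℝ (GroupLieAlgebra (𝓡 6) G) = 6 := by
    have h : Module.finrank ℝ (EuclideanSpace ℝ (Fin 6)) = 6 := by simp
    -- The Lie algebra is the tangent space at the identity, which unfolds to the model space.
    exact h
  exact ⟨⟨classification hL hab hnil, admits_of_classification⟩,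
    fun h => unimodular_classification (classification hL hab hnil h)⟩
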